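/- For $\alpha\in[0,1]$ and $x\in[\alpha-1,\alpha]$ put $T_\alpha(x)=|1/x|-\lfloor |1/x|+1-\alpha\rfloor$ if $x\ne0$, and $T_\alpha(0)=0$. The digit of $x$ is the letter $(\varepsilon(x):d_\alpha(x))$, where $\varepsilon(x)=+1$ if $x\ge0$, $\varepsilon(x)=-1$ if $x<0$, and $d_\alpha(x)=\lfloor|1/x|+1-\alpha\rfloor$, $d_\alpha(0)=\infty$. The $\alpha$-expansion of $x$ is the infinite word whose $n$-th letter ($n\ge1$) is the digit of $T_\alpha^{n-1}(x)$. Write $\underline b^\alpha_{[1,\infty)}$ and $\overline b^\alpha_{[1,\infty)}$ for the $\alpha$-expansions of $\alpha-1$ and of $\alpha$. Here $u_{[m,n]}=u_m u_{m+1}\cdots u_n$, $u_{[m,\infty)}=u_mu_{m+1}\cdots$, $|v|$ is the length of a finite word $v$, and $v^\omega=vvv\cdots$. Operations on words. On letters, ${}^{(W)}(\varepsilon:d)=(-\varepsilon:d+\varepsilon)$ and $(\varepsilon:d)^{(\pm1)}=(\varepsilon:d\pm1)$ if $d<\infty$, and $(+1:\infty)$ is fixed by these operations. On words, ${}^{(W)}$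 acts on the first letter and ${}^{(\pm1)}$ on the last letter. For $w=(\varepsilon_1:d_1)(\varepsilon_2:d_2)\cdots$ let $[\![w]\!]=\cfrac{\varepsilon_1}{d_1+\cfrac{\varepsilon_2}{d_2+\cdots}}$. Characteristic sequences. Let $\mathscr A_-=\{(-1:d)\mid d\in\mathbb Z,\ d\ge2\}$, and let $\mathscr A_-^*$ be the set of finite (possibly empty) words over $\mathscr A_-$. The characteristic sequence of $v\in\mathscr A_-^*$ is the sequence $a_1\cdots a_{2\ell+1}$ of integers $a_j\ge1$ ($\ell\ge0$) determined by $$v=(-1:2)^{a_1-1}(-1:2+a_2)(-1:2)^{a_3-1}\cdots(-1:2+a_{2\ell})(-1:2)^{a_{2\ell+1}-1},$$ and then $$\widehat v:=(-1:2+a_1)(-1:2)^{a_2-1}(-1:2+a_3)\cdots(-1:2)^{a_{2\ell}-1}(-1:2+a_{2\ell+1}).$$ The characteristic sequence $a_1a_2\cdots$ of an infinite word $w$ over $\mathscr A_-$ is determined by $w=(-1:2)^{a_1-1}(-1:2+a_2)(-1:2)^{a_3-1}(-1:2+a_4)\cdots$ with integers $a_j\ge1$ if $w$ does not end with $(-1:2)^\omega$,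 and then $\widehat w:=(-1:2+a_1)(-1:2)^{a_2-1}(-1:2+a_3)(-1:2)^{a_4-1}\cdots$. If $w=(-1:2)^{a_1-1}(-1:2+a_2)\cdots(-1:2)^{a_{2\ell-1}-1}(-1:2+a_{2\ell})(-1:2)^\omega$, then $a_j=\infty$ for all $j>2\ell$. The characteristic sequence of a number $x\in[-1,0)$ is that of its $0$-expansion. For two sequences of the same finite or infinite length, $a<_{\rm alt}a'$ means that they differ and that, at the first place $j+1$ ($j\ge0$) where they differ, $(-1)^ja_{j+1}<(-1)^ja'_{j+1}$; $\le_{\rm alt}$ means $<_{\rm alt}$ or equal. Let $g=(\sqrt5-1)/2$ and $$\Gamma=\{\alpha\in(0,1]\mid T_\alpha^n(\alpha-1)\ge0\text{ or }T_\alpha^n(\alpha)\ge0\text{ for some }n\ge1\}.$$ Let $\mathscr F$ be the set of $v\in\mathscr A_-^*$ whose characteristic sequence $a_{[1,2\ell+1]}$ satisfies $a_{[2j,2\ell+1]}<_{\rm alt}a_{[1,2\ell-2j+2]}$ and $a_{[2j+1,2\ell+1]}\le_{\rm alt}a_{[1,2\ell-2j+1]}$ for all $1\le j\le\ell$. For $v\in\mathscr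 F$ put $\zeta_v=[\![(v\,\widehat v)^\omega]\!]+1$; $\eta_v=[\![(v^{(+1)})^\omega]\!]+1$ if $|v|\ge1$, and $\eta_v=1$ if $|v|=0$; $\Gamma_v=(\zeta_v,\eta_v)$ if $|v|\ge1$, and $\Gamma_v=(g,1]$ if $|v|=0$. **Theorem.** 1. For all $v\in\mathscr F$ we have $\zeta_v<\eta_v$, and $\Gamma$ is the disjoint union of the intervals $\Gamma_v$, $v\in\mathscr F$. 2. For all $v\in\mathscr F$ and $\alpha\in\Gamma_v$, $$\underline b^\alpha_{[1,|v|]}=v,\qquad \overline b^\alpha_{[1,|\widehat v|]}={}^{(W)}\widehat v^{(-1)},\qquad \overline b^\alpha_{|\widehat v|+1}={}^{(W)}\underline b^\alpha_{|v|+1},\qquad T_\alpha^{|v|+1}(\alpha-1)=T_\alpha^{|\widehat v|+1}(\alpha).$$ 3. For real $\alpha$, we have $\alpha\in(0,1]\setminus\Gamma$ if and only if $\alpha\in(0,g]$ and the characteristic sequence $a_{[1,\infty)}$ of $\alpha-1$ satisfies $a_{[n,\infty)}\le_{\rm alt}a_{[1,\infty)}$ for all $n\ge2$. 4. The set $(0,1]\setminus\Gamma$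 has Lebesgue measure zero. 5. For every $\alpha\in(0,1]\setminus\Gamma$, the word $\underline b^\alpha_{[1,\infty)}$ is a word over $\mathscr A_-$ that does not end with $(-1:2)^\omega$, and $\overline b^\alpha_{[1,\infty)}={}^{(W)}\widehat{\underline b^\alpha_{[1,\infty)}}$. -/

import Mathlib

open Set Filter Topology MeasureTheory

namespace AlphaCF

/-! ### The maps and their digits -/

/-- The map `T_α(x) = |1/x| - ⌊|1/x| + 1 - α⌋` for `x ≠ 0`, and `T_α(0) = 0`. -/
noncomputable def T (α x : ℝ) : ℝ :=
  if x = 0 then 0 else |1 / x| - (⌊|1 / x| + 1 - α⌋ : ℤ)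

/-- Letters: `fin ε d` is `(ε : d)` with `d` an integer, and `inf` is `(+1 : ∞)`. -/
inductive Letter : Type
  | fin (ε d : ℤ) : Letter
  | inf : Letter
  deriving DecidableEq

/-- The letter `(-1 : 2)`. -/
def two : Letter := Letter.fin (-1) 2

/-- The alphabet of the letters `(-1 : d)`, `d ≥ 2`. -/
def Aminus : Set Letter := {a | ∃ d : ℤ, 2 ≤ d ∧ a = Letter.fin (-1) d}

/-- The digit `(ε(x) : d_α(x))`, with `ε(0) = +1` and `d_α(0) = ∞`. -/
noncomputable def digit (α x : ℝ) : Letter :=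
  if x = 0 then Letter.inf
  else Letter.fin (if 0 ≤ x then 1 else -1) ⌊|1 / x| + 1 - α⌋

/-- The `α`-expansion of `x`. Infinite words are functions on `ℕ`, so that the value at `n` is
the digit with the (one-based) number `n + 1`. -/
noncomputable def expansion (α x : ℝ) : ℕ → Letter := fun n => digit α ((T α)^[n] x)

/-- The word formed by the first `n` letters of an infinite word. -/
def pre {β : Type} (w : ℕ → β) (n : ℕ) : List β := (List.range n).map w

theorem pre_succ {β : Type} (w : ℕ → β) (n : ℕ) : pre w (n + 1) = pre w n ++ [w n] := by
  simp [pre, List.range_succ]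

theorem pre_cons {β : Type} (w : ℕ → β) (n : ℕ) :
    pre w (n + 1) = w 0 :: pre (fun i => w (i + 1)) n := by
  simp [pre, List.range_succ_eq_map, Function.comp_def]

theorem length_pre {β : Type} (w : ℕ → β) (n : ℕ) : (pre w n).length = n := by
  simp [pre]

/-! ### Operations on letters and words -/

/-- `(ε : d) ↦ (-ε : d + ε)`, and `(+1 : ∞)` is fixed. -/
def Letter.W : Letter → Letter
  | Letter.fin ε d => Letter.fin (-ε) (d + ε)
  | Letter.inf => Letter.inf

/-- `(ε : d) ↦ (ε : d + k)`, and `(+1 : ∞)` is fixed. -/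
def Letter.shift (k : ℤ) : Letter → Letter
  | Letter.fin ε d => Letter.fin ε (d + k)
  | Letter.inf => Letter.inf

/-- Left superscript `(W)` on finite words: it acts on the first letter. -/
def wordW : List Letter → List Letter
  | [] => []
  | a :: v => a.W :: v

/-- Left superscript `(W)` on infinite words: it acts on the first letter. -/
def streamW (w : ℕ → Letter) : ℕ → Letter
  | 0 => (w 0).W
  | n + 1 => w (n + 1)

/-- Right superscript `(k)`, `k = 1` or `k = -1`: it acts on the last letter. -/
def wordShift (k : ℤ) : List Letter → List Letter
  | [] => []
  | [a] => [a.shift k]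
  | a :: b :: v => a :: wordShift k (b :: v)

/-- The periodic infinite word with (non-empty) period `v`. -/
def periodic (v : List Letter) : ℕ → Letter := fun n => v.getD (n % v.length) Letter.inf

/-! ### Values of continued fractions -/

/-- `⟦(ε₁ : d₁) ⋯ (εₙ : dₙ), y⟧ = ε₁ / (d₁ + ⋯ + εₙ / (dₙ + y))`. -/
noncomputable def cfWord : List Letter → ℝ → ℝ
  | [], y => y
  | Letter.fin ε d :: v, y => (ε : ℝ) / ((d : ℝ) + cfWord v y)
  | Letter.inf :: _, _ => 0

/-- The value `⟦w⟧` of an infinite word `w`: the limit of its finite truncations. -/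
noncomputable def cfStream (w : ℕ → Letter) : ℝ :=
  limUnder atTop (fun n => cfWord (pre w n) 0)

theorem cfWord_mem (v : List Letter) (hv : ∀ x ∈ v, x ∈ Aminus) (y : ℝ) (h1 : -1 ≤ y)
    (h0 : y ≤ 0) : -1 ≤ cfWord v y ∧ cfWord v y ≤ 0 := by
  induction v with
  | nil => exact ⟨h1, h0⟩
  | cons a v ih =>
    obtain ⟨l, u⟩ := ih (fun x hx => hv x (List.mem_cons_of_mem _ hx))
    obtain ⟨d, hd, rfl⟩ := hv a List.mem_cons_self
    have hd' : (2 : ℝ) ≤ d := by exact_mod_cast hd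
    have hp : (1 : ℝ) ≤ d + cfWord v y := by linarith
    simp only [cfWord, Int.cast_neg, Int.cast_one, neg_div]
    have h2 : 1 / ((d : ℝ) + cfWord v y) ≤ 1 := by
      rw [div_le_one (by linarith)]; exact hp
    have h3 : 0 ≤ 1 / ((d : ℝ) + cfWord v y) := by positivity
    constructor <;> linarith

theorem cfWord_mono (v : List Letter) (hv : ∀ x ∈ v, x ∈ Aminus) (y z : ℝ) (h1 : -1 ≤ y)
    (hyz : y ≤ z) (h0 : z ≤ 0) : cfWord v y ≤ cfWord v z := by
  induction v with
  | nil => exact hyz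
  | cons a v ih =>
    have hv' : ∀ x ∈ v, x ∈ Aminus := fun x hx => hv x (List.mem_cons_of_mem _ hx)
    have hm := cfWord_mem v hv' y h1 (hyz.trans h0)
    obtain ⟨d, hd, rfl⟩ := hv a List.mem_cons_self
    have hd' : (2 : ℝ) ≤ d := by exact_mod_cast hd
    simp only [cfWord, Int.cast_neg, Int.cast_one, neg_div]
    have := ih hv'
    apply neg_le_neg
    apply one_div_le_one_div_of_le <;> linarith

theorem cfWord_append (u v : List Letter) (hu : ∀ x ∈ u, x ∈ Aminus) (y : ℝ) :
    cfWord (u ++ v) y = cfWord u (cfWord v y) := by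
  induction u with
  | nil => rfl
  | cons a u ih =>
    obtain ⟨d, -, rfl⟩ := hu a List.mem_cons_self
    simp only [List.cons_append, cfWord, ih (fun x hx => hu x (List.mem_cons_of_mem _ hx))]

/-- For an infinite word over `Aminus` the truncations converge, so that `cfStream` is their
limit. -/
theorem tendsto_cfStream (w : ℕ → Letter) (hw : ∀ n, w n ∈ Aminus) :
    Tendsto (fun n => cfWord (pre w n) 0) atTop (𝓝 (cfStream w)) := by
  have hp : ∀ n, ∀ x ∈ pre w n, x ∈ Aminus := by
    intro n x hx
    simp only [pre, List.mem_map] at hx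
    obtain ⟨i, -, rfl⟩ := hx
    exact hw i
  have ha : Antitone (fun n => cfWord (pre w n) 0) := by
    apply antitone_nat_of_succ_le
    intro n
    have h1 : ∀ x ∈ [w n], x ∈ Aminus := by
      intro x hx
      rw [List.mem_singleton] at hx
      exact hx ▸ hw n
    have hm := cfWord_mem [w n] h1 0 (by norm_num) le_rfl
    show cfWord (pre w (n + 1)) 0 ≤ cfWord (pre w n) 0
    rw [pre_succ, cfWord_append _ _ (hp n)]
    exact cfWord_mono _ (hp n) _ _ hm.1 hm.2 le_rfl
  have hb : BddBelow (range (fun n => cfWord (pre w n) 0)) := by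
    refine ⟨-1, ?_⟩
    rintro _ ⟨n, rfl⟩
    exact (cfWord_mem _ (hp n) 0 (by norm_num) le_rfl).1
  exact tendsto_nhds_limUnder ⟨_, tendsto_atTop_ciInf ha hb⟩

/-! ### Characteristic sequences and the operation `v ↦ v̂` -/

/-- The word `(-1:2)^(a₁-1) (-1:2+a₂) (-1:2)^(a₃-1) (-1:2+a₄) ⋯`, for a finite sequence. -/
def wordOfChar : List ℕ → List Letter
  | [] => []
  | [a] => List.replicate (a - 1) two
  | a :: b :: s => List.replicate (a - 1) two ++ Letter.fin (-1) (2 + b) :: wordOfChar s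

/-- The word `(-1:2+a₁) (-1:2)^(a₂-1) (-1:2+a₃) (-1:2)^(a₄-1) ⋯`, for a finite sequence. -/
def hatOfChar : List ℕ → List Letter
  | [] => []
  | [a] => [Letter.fin (-1) (2 + a)]
  | a :: b :: s => Letter.fin (-1) (2 + a) :: (List.replicate (b - 1) two ++ hatOfChar s)

/-- `d - 2` for a letter `(-1 : d)` with `d ≥ 2`. -/
def Letter.excess : Letter → ℕ
  | Letter.fin _ d => (d - 2).toNat
  | Letter.inf => 0

/-- The characteristic sequence `a₁ ⋯ a_{2ℓ+1}` of a finite word `v` over `Aminus`; see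
`charWord_spec` and `charWord_unique`. -/
def charWord : List Letter → List ℕ
  | [] => [1]
  | x :: v =>
    if x = two then (charWord v).modifyHead (· + 1)
    else 1 :: x.excess :: charWord v

/-- `charWord v` is a sequence of positive integers of odd length, and `v` is recovered from
it. -/
theorem charWord_spec (v : List Letter) (hv : ∀ x ∈ v, x ∈ Aminus) :
    Odd (charWord v).length ∧ (∀ a ∈ charWord v, 1 ≤ a) ∧ wordOfChar (charWord v) = v := by
  induction v with
  | nil => simp [charWord, wordOfChar]
  | cons x v ih =>
    obtain ⟨h1, h2, h3⟩ := ih (fun x hx => hv x (List.mem_cons_of_mem _ hx))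
    obtain ⟨d, hd, rfl⟩ := hv x List.mem_cons_self
    by_cases hx : Letter.fin (-1) d = two
    · rw [charWord, if_pos hx]
      match hc : charWord v with
      | [] => simp [hc] at h1
      | [a] =>
        rw [hc] at h2 h3
        have ha : 1 ≤ a := h2 a (by simp)
        obtain ⟨b, rfl⟩ := Nat.exists_eq_add_of_le' ha
        simp only [wordOfChar, Nat.add_sub_cancel] at h3
        simp [List.modifyHead, wordOfChar, ← h3, List.replicate_succ, hx]
      | a :: c :: s =>
        rw [hc] at h1 h2 h3
        have ha : 1 ≤ a := h2 a (by simp)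
        obtain ⟨b, rfl⟩ := Nat.exists_eq_add_of_le' ha
        simp only [wordOfChar, Nat.add_sub_cancel] at h3
        refine ⟨by simpa [List.modifyHead] using h1, ?_, ?_⟩
        · intro y hy
          simp only [List.modifyHead, List.mem_cons] at hy
          rcases hy with rfl | hy | hy
          · omega
          · exact h2 y (by simp [hy])
          · exact h2 y (by simp [hy])
        · simp [List.modifyHead, wordOfChar, ← h3, List.replicate_succ, hx]
    · rw [charWord, if_neg hx]
      have hd2 : d ≠ 2 := fun h => hx (by rw [h]; rfl)
      refine ⟨?_, ?_, ?_⟩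
      · simp only [List.length_cons]
        rcases h1 with ⟨k, hk⟩
        exact ⟨k + 1, by omega⟩
      · intro y hy
        simp only [List.mem_cons, Letter.excess] at hy
        rcases hy with rfl | rfl | hy
        · exact le_rfl
        · omega
        · exact h2 y hy
      · simp only [wordOfChar, h3, Letter.excess]
        have : (2 : ℤ) + ((d - 2).toNat : ℕ) = d := by omega
        rw [this]
        rfl

theorem charWord_replicate_append (k : ℕ) (v : List Letter) :
    charWord (List.replicate k two ++ v) = (charWord v).modifyHead (· + k) := by
  induction k with
  | zero =>
    rw [List.replicate_zero, List.nil_append]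
    cases charWord v <;> rfl
  | succ k ih =>
    rw [List.replicate_succ, List.cons_append, charWord, if_pos rfl, ih]
    cases charWord v <;> simp [List.modifyHead, Nat.add_assoc]

/-- `charWord v` is the only sequence as in `charWord_spec`. -/
theorem charWord_unique : ∀ (a : List ℕ), Odd a.length → (∀ x ∈ a, 1 ≤ x) →
    charWord (wordOfChar a) = a
  | [], h, _ => by simp at h
  | [a], _, h => by
    have ha : 1 ≤ a := h a (by simp)
    have := charWord_replicate_append (a - 1) []
    rw [List.append_nil] at this
    rw [wordOfChar, this]
    simp [charWord]
    omega
  | a :: b :: s, h, hp => by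
    have ha : 1 ≤ a := hp a (by simp)
    have hb : 1 ≤ b := hp b (by simp)
    have ih := charWord_unique s (by
      rcases h with ⟨k, hk⟩
      simp only [List.length_cons] at hk
      exact ⟨k - 1, by omega⟩) (fun x hx => hp x (by simp [hx]))
    have hne : Letter.fin (-1) (2 + (b : ℤ)) ≠ two := by
      intro h
      simp only [two, Letter.fin.injEq] at h
      omega
    rw [wordOfChar, charWord_replicate_append, charWord, if_neg hne, ih]
    simp [Letter.excess]
    omega

/-- The word `v̂` of a finite word `v` over `Aminus`. -/
def hat (v : List Letter) : List Letter := hatOfChar (charWord v)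

/-- The number of letters `(-1:2)` at the beginning of an infinite word. -/
noncomputable def lead (w : ℕ → Letter) : ℕ∞ :=
  open Classical in
  if h : ∃ i, w i ≠ two then ((Nat.find h : ℕ) : ℕ∞) else ⊤

/-- The excess `d - 2` of the first letter other than `(-1:2)` of an infinite word
(`⊤` if there is none). -/
noncomputable def leadExcess (w : ℕ → Letter) : ℕ∞ :=
  open Classical in
  if h : ∃ i, w i ≠ two then ((w (Nat.find h)).excess : ℕ∞) else ⊤

/-- What follows the first letter other than `(-1:2)` in an infinite word
(the word itself if there is none). -/
noncomputable def afterLead (w : ℕ → Letter) : ℕ → Letter :=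
  open Classical in
  if h : ∃ i, w i ≠ two then fun n => w (Nat.find h + 1 + n) else w

/-- The characteristic sequence of an infinite word over `Aminus`; the value at `n` is the term
`a_{n+1}`, in `ℕ ∪ {∞}`. See `charStream_spec` and `charStream_eq_top`. -/
noncomputable def charStream (w : ℕ → Letter) : ℕ → ℕ∞ := fun n =>
  if n % 2 = 0 then lead (afterLead^[n / 2] w) + 1 else leadExcess (afterLead^[n / 2] w)

/-- The infinite word `ŵ` of an infinite word `w` over `Aminus` that does not end with
`(-1:2)^ω`. The blocks `(-1:2+a_{2i-1}) (-1:2)^(a_{2i}-1)` have length at least `1`, hence the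
letter with index `n` can be read off from the first `n + 1` blocks; see `hatStream_spec`. -/
noncomputable def hatStream (w : ℕ → Letter) : ℕ → Letter := fun n =>
  (hatOfChar (pre (fun i => (charStream w i).toNat) (2 * (n + 1)))).getD n Letter.inf

theorem charStream_add_two (w : ℕ → Letter) (i : ℕ) :
    charStream w (i + 2) = charStream (afterLead w) i := by
  simp [charStream]

/-- If the first `2k` terms of the characteristic sequence of `w` are finite, then the
corresponding word is a prefix of `w`, and `afterLead^[k] w` is what follows this prefix. -/
theorem charStream_spec (w : ℕ → Letter) (hw : ∀ n, w n ∈ Aminus) (k : ℕ)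
    (hk : ∀ i < 2 * k, charStream w i ≠ ⊤) :
    (∀ i < 2 * k, 1 ≤ charStream w i) ∧
    ∃ n, pre w n = wordOfChar (pre (fun i => (charStream w i).toNat) (2 * k)) ∧
      afterLead^[k] w = fun m => w (n + m) := by
  classical
  induction k generalizing w with
  | zero => exact ⟨by simp, 0, by simp [pre, wordOfChar], by simp⟩
  | succ k ih =>
    have hex : ∃ i, w i ≠ two := by
      by_contra h
      exact hk 0 (by omega) (by simp [charStream, lead, h])
    have hal : afterLead w = fun n => w (Nat.find hex + 1 + n) := by
      simp [afterLead, hex]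
    have hlead : charStream w 0 = ((Nat.find hex + 1 : ℕ) : ℕ∞) := by
      simp [charStream, lead, hex]
    have hexc : charStream w 1 = (((w (Nat.find hex)).excess : ℕ) : ℕ∞) := by
      simp [charStream, leadExcess, hex]
    have hpos : 1 ≤ (w (Nat.find hex)).excess ∧
        w (Nat.find hex) = Letter.fin (-1) (2 + ((w (Nat.find hex)).excess : ℤ)) := by
      have h1 := Nat.find_spec hex
      obtain ⟨d, hd, he⟩ := hw (Nat.find hex)
      rw [he] at h1 ⊢
      have hd2 : d ≠ 2 := fun h => h1 (by rw [h]; rfl)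
      simp only [Letter.excess, Letter.fin.injEq, true_and]
      omega
    obtain ⟨hp, n, hn, ha⟩ := ih (afterLead w) (by intro n; rw [hal]; exact hw _) (by
      intro i hi
      rw [← charStream_add_two]
      exact hk (i + 2) (by omega))
    refine ⟨?_, Nat.find hex + 1 + n, ?_, ?_⟩
    · intro i hi
      match i with
      | 0 => rw [hlead]; exact_mod_cast Nat.le_add_left 1 _
      | 1 => rw [hexc]; exact_mod_cast hpos.1
      | i + 2 => rw [charStream_add_two]; exact hp i (by omega)
    · have e : 2 * (k + 1) = 2 * k + 1 + 1 := by ring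
      rw [e, pre_cons, pre_cons]
      simp only [zero_add, Nat.add_assoc, Nat.reduceAdd, charStream_add_two]
      rw [wordOfChar, ← hn, hlead, hexc, ENat.toNat_natCast, ENat.toNat_natCast, ← hpos.2,
        Nat.add_sub_cancel]
      have hsplit : ∀ m l, pre w (m + l) = pre w m ++ pre (fun i => w (m + i)) l := by
        intro m l
        simp [pre, List.range_add, Function.comp_def]
      rw [← Nat.add_assoc, hsplit, pre_succ, hal, List.append_assoc]
      congr 1
      rw [pre, List.eq_replicate_iff]
      refine ⟨by simp, ?_⟩
      intro b hb
      simp only [List.mem_map, List.mem_range] at hb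
      obtain ⟨i, hi, rfl⟩ := hb
      exact not_not.1 (Nat.find_min hex hi)
    · rw [Function.iterate_succ_apply, ha, hal]
      funext m
      simp only [Nat.add_assoc]

theorem charStream_finite_pair (w : ℕ → Letter) (k : ℕ) :
    charStream w (2 * k) = ⊤ ↔ charStream w (2 * k + 1) = ⊤ := by
  have h1 : (2 * k + 1) / 2 = k := by omega
  have h2 : (2 * k + 1) % 2 = 1 := by omega
  by_cases h : ∃ i, afterLead^[k] w i ≠ two <;>
    simp [charStream, lead, leadExcess, h, h1, h2, -ne_eq]

/-- If the term with the (zero-based) index `2k` is infinite, then `afterLead^[k] w` is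
`(-1:2)^ω`, and all later terms are infinite. -/
theorem charStream_eq_top (w : ℕ → Letter) (k : ℕ) (h : charStream w (2 * k) = ⊤) :
    (∀ m, afterLead^[k] w m = two) ∧ ∀ i, 2 * k ≤ i → charStream w i = ⊤ := by
  have hno : ¬ ∃ i, afterLead^[k] w i ≠ two := by
    intro hex
    simp [charStream, lead, hex, -ne_eq] at h
  have hfix : ∀ m, afterLead^[m] (afterLead^[k] w) = afterLead^[k] w := by
    intro m
    induction m with
    | zero => rfl
    | succ m ih =>
      rw [Function.iterate_succ_apply]
      have : afterLead (afterLead^[k] w) = afterLead^[k] w := by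
        conv_lhs => rw [afterLead]
        rw [dif_neg hno]
      rw [this, ih]
  refine ⟨fun m => not_not.1 fun hm => hno ⟨m, hm⟩, fun i hi => ?_⟩
  have hi2 : i / 2 = (i / 2 - k) + k := by omega
  have hit : afterLead^[i / 2] w = afterLead^[k] w := by
    rw [hi2, Function.iterate_add_apply, hfix]
  unfold charStream lead leadExcess
  rw [hit, dif_neg hno, dif_neg hno]
  simp

theorem hatOfChar_append_prefix (a : ℕ → ℕ) (k m : ℕ) :
    hatOfChar (pre a (2 * k)) <+: hatOfChar (pre a (2 * (k + m))) ∧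
      k ≤ (hatOfChar (pre a (2 * k))).length := by
  induction k generalizing a with
  | zero => simp [pre, hatOfChar]
  | succ k ih =>
    obtain ⟨h1, h2⟩ := ih (fun i => a (i + 2))
    have e1 : 2 * (k + 1) = 2 * k + 1 + 1 := by ring
    have e2 : 2 * (k + 1 + m) = 2 * (k + m) + 1 + 1 := by ring
    rw [e1, e2, pre_cons, pre_cons, pre_cons, pre_cons]
    simp only [Nat.add_assoc, Nat.reduceAdd, zero_add, hatOfChar]
    refine ⟨?_, ?_⟩
    · rw [List.cons_prefix_cons]
      exact ⟨rfl, (List.prefix_append_right_inj _).2 h1⟩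
    · simp only [List.length_cons, List.length_append]
      omega

/-- For each `k`, the first `k` blocks `(-1:2+a_{2i-1}) (-1:2)^(a_{2i}-1)` form a prefix of
`hatStream w`. -/
theorem hatStream_spec (w : ℕ → Letter) (k : ℕ) :
    ∃ n, k ≤ n ∧
      pre (hatStream w) n = hatOfChar (pre (fun i => (charStream w i).toNat) (2 * k)) := by
  set a : ℕ → ℕ := fun i => (charStream w i).toNat with ha
  refine ⟨_, (hatOfChar_append_prefix a k 0).2, ?_⟩
  apply List.ext_getElem
  · rw [length_pre]
  · intro i h1 h2
    have hpre : ∀ p q, i < (hatOfChar (pre a (2 * p))).length → p ≤ q →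
        (hatOfChar (pre a (2 * q))).getD i Letter.inf =
          (hatOfChar (pre a (2 * p))).getD i Letter.inf := by
      intro p q hi hpq
      obtain ⟨m, rfl⟩ := Nat.exists_eq_add_of_le hpq
      obtain ⟨t, ht⟩ := (hatOfChar_append_prefix a p m).1
      rw [← ht, List.getD_append _ _ _ _ hi]
    have hi1 : i < (hatOfChar (pre a (2 * (i + 1)))).length :=
      (hatOfChar_append_prefix a (i + 1) 0).2
    have hL : (pre (hatStream w) (hatOfChar (pre a (2 * k))).length)[i] =
        (hatOfChar (pre a (2 * (i + 1)))).getD i Letter.inf := by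
      simp [pre, hatStream, ha]
    rw [hL, ← List.getD_eq_getElem _ Letter.inf h2]
    rcases le_total k (i + 1) with h | h
    · exact hpre k (i + 1) h2 h
    · exact (hpre (i + 1) k hi1 h).symm

/-- The characteristic sequence of a number `x ∈ [-1, 0)`: that of its by-excess expansion. -/
noncomputable def charNum (x : ℝ) : ℕ → ℕ∞ := charStream (expansion 0 x)

/-! ### The alternating order -/

/-- Strict alternating order on finite sequences of the same length: at the first (zero-based)
place `j` where the sequences differ, the first one is smaller if `j` is even, and larger if `j`
is odd. -/
def AltLT (s t : List ℕ) : Prop :=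
  s.length = t.length ∧ ∃ j < s.length, s.take j = t.take j ∧
    if Even j then s.getD j 0 < t.getD j 0 else t.getD j 0 < s.getD j 0

/-- Non-strict alternating order on finite sequences. -/
def AltLE (s t : List ℕ) : Prop := AltLT s t ∨ s = t

/-- Strict alternating order on infinite sequences. -/
def AltLTStream (a b : ℕ → ℕ∞) : Prop :=
  ∃ j, (∀ i < j, a i = b i) ∧ if Even j then a j < b j else b j < a j

/-- Non-strict alternating order on infinite sequences. -/
def AltLEStream (a b : ℕ → ℕ∞) : Prop := AltLTStream a b ∨ a = b

/-! ### The synchronization set, its labels and its intervals -/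

/-- The golden mean `g = (√5 - 1) / 2`. -/
noncomputable def g : ℝ := (Real.sqrt 5 - 1) / 2

/-- The set `Γ`. -/
def Γ : Set ℝ :=
  {α | α ∈ Ioc (0 : ℝ) 1 ∧ ∃ n : ℕ, 1 ≤ n ∧ (0 ≤ (T α)^[n] (α - 1) ∨ 0 ≤ (T α)^[n] α)}

/-- The set of labels. With `a` the characteristic sequence of `v`, of length `2ℓ + 1`, the
sequences compared are `a_{[2j,2ℓ+1]}` with `a_{[1,2ℓ-2j+2]}`, and `a_{[2j+1,2ℓ+1]}` with
`a_{[1,2ℓ-2j+1]}`. -/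
def F : Set (List Letter) :=
  {v | (∀ x ∈ v, x ∈ Aminus) ∧ ∀ ℓ : ℕ, (charWord v).length = 2 * ℓ + 1 →
    ∀ j : ℕ, 1 ≤ j → j ≤ ℓ →
      AltLT ((charWord v).drop (2 * j - 1)) ((charWord v).take (2 * ℓ - 2 * j + 2)) ∧
      AltLE ((charWord v).drop (2 * j)) ((charWord v).take (2 * ℓ - 2 * j + 1))}

/-- `ζ_v = ⟦(v v̂)^ω⟧ + 1`. -/
noncomputable def ζ (v : List Letter) : ℝ := cfStream (periodic (v ++ hat v)) + 1

/-- `η_v = ⟦(v^{(+1)})^ω⟧ + 1` if `|v| ≥ 1`, and `η_v = 1` for the empty word. -/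
noncomputable def η (v : List Letter) : ℝ :=
  if v = [] then 1 else cfStream (periodic (wordShift 1 v)) + 1

/-- `Γ_v = (ζ_v, η_v)` if `|v| ≥ 1`, and `Γ_v = (g, 1]` for the empty word. -/
noncomputable def Γv (v : List Letter) : Set ℝ :=
  if v = [] then Ioc g 1 else Ioo (ζ v) (η v)

end AlphaCF

open AlphaCF

namespace AlphaCF


/-! The dictionary behind the proof is between by-excess and regular continued fractions. If `s` is
the characteristic sequence of a word, then adding 1 to the value of the word turns it into the
regular continued fraction `rcf s`, up to a change of the tail that depends on the parity of the
length (`cfWord_wordOfChar_of_even`, `cfWord_wordOfChar_of_odd`). The word with a hat is, after its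
first letter, the word of the sequence without its first term (`hatOfChar_cons`). The alternating
order on sequences is the reversed order of the values. Hence the condition in part 3 says that α is
minimal in its orbit under the Gauss map G, and the core of the proof is that the complement of Γ is
the set `gaussMinimal` (`Γ_compl_eq`).

If α is minimal, the numbers Gⁿ(α) - 1 lie in [α - 1, 0). So T_α acts on α - 1, and on T_α(α) = G(α)
- 1, as the by-excess map does, and both orbits stay negative. This gives one inclusion and part 5.

If α is not minimal, let N be the first time with G^N(α) < α. Minimality before N makes the first N
partial quotients admissible. Of the two expansions a₁⋯(aₙ + 1) and a₁⋯aₙ 1 of the same rational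
number, take the one of odd length, s. Then α = rcf s u with 1/(1 + α) - 1 < u < α. As `rcf s` is
decreasing, this means rcf s α < α < rcf s (1/(1 + α) - 1), and as ζ_v and η_v are the fixed points
of the two contractions involved, it means α ∈ Γ_v (`mem_Γv_iff`, `exists_mem_Γv`). Since N and the
partial quotients depend on α only, the intervals are disjoint.

Conversely, α ∈ Γ_v provides such a u by the intermediate value theorem. Admissibility keeps all
suffix values rcf (s.drop m) u at or above α (`Admissible.le_rcf_drop`), so the orbit of α - 1 reads
v and arrives at x = 1/(1 + u) - 1, while the orbit of α reads the modified hat word and arrives at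
u (`synchronization`). The relation (1 + x)(1 + u) = 1 makes the orbits merge at the next step
(`merge`) and excludes that both x and u are negative.

For part 4, orbits of minimal numbers are bounded away from 0. Such numbers use only finitely many
inverse branches of G, and the Gauss measure of a set that is covered by these branches applied to
itself must vanish. -/

/-! ### Regular continued fractions -/

/-- The regular continued fraction `[0; a₁, …, aₙ + y]`. -/
noncomputable def rcf : List ℕ → ℝ → ℝ
  | [], y => y
  | a :: s, y => ((a : ℝ) + rcf s y)⁻¹

/-- All terms are positive. -/
def Pos (s : List ℕ) : Prop := ∀ a ∈ s, 1 ≤ a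

theorem Pos.head {a : ℕ} {s : List ℕ} (h : Pos (a :: s)) : (1 : ℝ) ≤ a := by
  exact_mod_cast h a (by simp)

theorem Pos.tail {a : ℕ} {s : List ℕ} (h : Pos (a :: s)) : Pos s :=
  fun b hb => h b (List.mem_cons_of_mem _ hb)

theorem Pos.drop {s : List ℕ} (h : Pos s) (m : ℕ) : Pos (s.drop m) :=
  fun b hb => h b (List.mem_of_mem_drop hb)

theorem Pos.take {s : List ℕ} (h : Pos s) (m : ℕ) : Pos (s.take m) :=
  fun b hb => h b (List.mem_of_mem_take hb)

theorem rcf_append (s t : List ℕ) (y : ℝ) : rcf (s ++ t) y = rcf s (rcf t y) := by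
  induction s with
  | nil => rfl
  | cons a s ih => simp [rcf, ih]

theorem rcf_gt {s : List ℕ} (hs : Pos s) {y : ℝ} (hy : -1 < y) :
    -1 < rcf s y ∧ (s ≠ [] → 0 < rcf s y) := by
  induction s with
  | nil => exact ⟨hy, fun h => absurd rfl h⟩
  | cons a s ih =>
    have h1 := (ih hs.tail).1
    have h2 := hs.head
    have : 0 < rcf (a :: s) y := by
      simp only [rcf]
      apply inv_pos.2
      linarith
    exact ⟨by linarith, fun _ => this⟩

theorem rcf_pos {s : List ℕ} (hs : Pos s) (hne : s ≠ []) {y : ℝ} (hy : -1 < y) :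
    0 < rcf s y := (rcf_gt hs hy).2 hne

theorem rcf_nonneg {s : List ℕ} (hs : Pos s) {y : ℝ} (hy : 0 ≤ y) : 0 ≤ rcf s y := by
  cases s with
  | nil => exact hy
  | cons a s => exact (rcf_pos hs (by simp) (by linarith)).le

theorem rcf_le_one {s : List ℕ} (hs : Pos s) (hne : s ≠ []) {y : ℝ} (hy : 0 ≤ y) :
    rcf s y ≤ 1 := by
  cases s with
  | nil => exact absurd rfl hne
  | cons a s =>
    have h1 := rcf_nonneg hs.tail hy
    have h2 := hs.head
    simp only [rcf]
    apply inv_le_one_of_one_le₀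
    linarith

theorem rcf_mem_Icc {s : List ℕ} (hs : Pos s) {y : ℝ} (hy : y ∈ Icc (0 : ℝ) 1) :
    rcf s y ∈ Icc (0 : ℝ) 1 := by
  cases s with
  | nil => exact hy
  | cons a s => exact ⟨rcf_nonneg hs hy.1, rcf_le_one hs (by simp) hy.1⟩

theorem rcf_strict {s : List ℕ} (hs : Pos s) {y z : ℝ} (hy : -1 < y) (hyz : y < z) :
    (Even s.length → rcf s y < rcf s z) ∧ (¬ Even s.length → rcf s z < rcf s y) := by
  induction s with
  | nil => simpa [rcf] using hyz
  | cons a s ih =>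
    have h1 := (rcf_gt hs.tail hy).1
    have h1' := (rcf_gt hs.tail (hy.trans hyz)).1
    have h2 := hs.head
    obtain ⟨i1, i2⟩ := ih hs.tail
    simp only [List.length_cons, Nat.even_add_one, not_not, rcf]
    constructor
    · intro h
      exact inv_strictAnti₀ (by linarith) (by linarith [i2 h])
    · intro h
      exact inv_strictAnti₀ (by linarith) (by linarith [i1 h])

theorem rcf_lt_of_even {s : List ℕ} (hs : Pos s) {y z : ℝ} (hy : -1 < y) (hyz : y < z)
    (h : Even s.length) : rcf s y < rcf s z := (rcf_strict hs hy hyz).1 h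

theorem rcf_lt_of_not_even {s : List ℕ} (hs : Pos s) {y z : ℝ} (hy : -1 < y) (hyz : y < z)
    (h : ¬ Even s.length) : rcf s z < rcf s y := (rcf_strict hs hy hyz).2 h

/-- Each term divides the distance of two points p, q ≥ 0 by (a + p)(a + q) ≥ 1, and this factor
exceeds 1 if p ≠ q. The strict form gives uniqueness of fixed points. -/
theorem abs_rcf_sub_le {s : List ℕ} (hs : Pos s) {y z : ℝ} (hy : 0 ≤ y) (hz : 0 ≤ z) :
    |rcf s y - rcf s z| ≤ |y - z| ∧ (s ≠ [] → y ≠ z → |rcf s y - rcf s z| < |y - z|) := by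
  induction s with
  | nil => simp [rcf]
  | cons a s ih =>
    have h1 := rcf_nonneg hs.tail hy
    have h2 := rcf_nonneg hs.tail hz
    have h3 := hs.head
    obtain ⟨i1, i2⟩ := ih hs.tail
    have key : |rcf (a :: s) y - rcf (a :: s) z| =
        |rcf s y - rcf s z| / ((a + rcf s y) * (a + rcf s z)) := by
      simp only [rcf]
      rw [inv_sub_inv (by linarith) (by linarith), abs_div,
        abs_of_pos (a := (a + rcf s y) * (a + rcf s z)) (by positivity), abs_sub_comm]
      congr 2
      ring
    have hden : 1 ≤ (a + rcf s y) * (a + rcf s z) := by nlinarith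
    have hle : |rcf (a :: s) y - rcf (a :: s) z| ≤ |rcf s y - rcf s z| := by
      rw [key]
      exact div_le_self (abs_nonneg _) hden
    refine ⟨hle.trans i1, fun _ hne => ?_⟩
    by_cases hsn : s = []
    · subst hsn
      simp only [rcf] at *
      rw [key]
      apply div_lt_self (abs_pos.2 (sub_ne_zero.2 hne))
      rcases hne.lt_or_gt with h | h
      · nlinarith
      · nlinarith
    · exact hle.trans_lt (i2 hsn hne)

/-- The map `u ↦ u - [0; a₁, …, aₙ + u]` is strictly increasing. -/
theorem sub_rcf_strict {s : List ℕ} (hs : Pos s) (hne : s ≠ []) {y z : ℝ} (hy : 0 ≤ y)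
    (hyz : y < z) : y - rcf s y < z - rcf s z := by
  have := (abs_rcf_sub_le hs (hy.trans hyz.le) hy).2 hne hyz.ne'
  rw [abs_of_pos (a := z - y) (by linarith)] at this
  linarith [le_abs_self (rcf s z - rcf s y)]

theorem continuousOn_rcf {s : List ℕ} (hs : Pos s) : ContinuousOn (rcf s) (Ioi (-1)) := by
  induction s with
  | nil => exact continuousOn_id
  | cons a s ih =>
    have := ih hs.tail
    apply ContinuousOn.inv₀
    · exact continuousOn_const.add this
    · intro y hy
      have := (rcf_gt hs.tail hy).1
      have := hs.head
      linarith

/-! ### The alternating order -/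

/-- Removing a common first term exchanges the two sequences, just as y ↦ 1/(a + y) reverses the
order. All comparisons below are inductions along this recursion. -/
theorem altLT_cons (a b : ℕ) (s t : List ℕ) :
    AltLT (a :: s) (b :: t) ↔ (s.length = t.length ∧ a < b) ∨ (a = b ∧ AltLT t s) := by
  unfold AltLT
  constructor
  · rintro ⟨hl, j, hj, ht, hc⟩
    have hl' : s.length = t.length := by simpa using hl
    cases j with
    | zero => exact Or.inl ⟨hl', by simpa using hc⟩
    | succ j =>
      simp only [List.take_succ_cons, List.cons.injEq, List.length_cons] at ht hj
      refine Or.inr ⟨ht.1, hl'.symm, j, by omega, ht.2.symm, ?_⟩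
      simp only [List.getD_cons_succ, Nat.even_add_one] at hc
      by_cases h : Even j
      · simpa [h] using hc
      · simpa [h] using hc
  · rintro (⟨hl, hab⟩ | ⟨rfl, hl, j, hj, ht, hc⟩)
    · exact ⟨by simpa using hl, 0, by simp, by simp, by simpa using hab⟩
    · refine ⟨by simpa using hl.symm, j + 1, by simp; omega, by simp [ht], ?_⟩
      simp only [List.getD_cons_succ, Nat.even_add_one]
      by_cases h : Even j
      · simpa [h] using hc
      · simpa [h] using hc

theorem not_altLT_nil (s : List ℕ) : ¬ AltLT [] s := by
  rintro ⟨-, j, hj, -⟩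
  simp at hj

theorem altLT_trichotomy : ∀ (s t : List ℕ), s.length = t.length →
    AltLT s t ∨ s = t ∨ AltLT t s
  | [], [], _ => Or.inr (Or.inl rfl)
  | [], _ :: _, h => by simp at h
  | _ :: _, [], h => by simp at h
  | a :: s, b :: t, h => by
    have hl : s.length = t.length := by simpa using h
    rw [altLT_cons, altLT_cons]
    rcases lt_trichotomy a b with hab | rfl | hab
    · exact Or.inl (Or.inl ⟨hl, hab⟩)
    · rcases altLT_trichotomy s t hl with h1 | h1 | h1
      · exact Or.inr (Or.inr (Or.inr ⟨rfl, h1⟩))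
      · exact Or.inr (Or.inl (by rw [h1]))
      · exact Or.inl (Or.inr ⟨rfl, h1⟩)
    · exact Or.inr (Or.inr (Or.inl ⟨hl.symm, hab⟩))

/-- The tails range over the closed interval [0, 1], so equality is possible, as in [0; a, 1] = [0;
a + 1]. With remainders below 1 the comparison becomes strict, see `lt_of_altLT_dig`. -/
theorem rcf_le_of_altLT : ∀ {s t : List ℕ}, Pos s → Pos t → AltLT s t →
    ∀ {y z : ℝ}, y ∈ Icc (0 : ℝ) 1 → z ∈ Icc (0 : ℝ) 1 → rcf t z ≤ rcf s y
  | [], t, _, _, h, _, _, _, _ => absurd h (not_altLT_nil t)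
  | a :: s, [], _, _, h, _, _, _, _ => by simp [AltLT] at h
  | a :: s, b :: t, hs, ht, h, y, z, hy, hz => by
    rw [altLT_cons] at h
    have h1 := rcf_mem_Icc hs.tail hy
    have h2 := rcf_mem_Icc ht.tail hz
    have h3 := hs.head
    simp only [rcf]
    rcases h with ⟨-, hab⟩ | ⟨rfl, h⟩
    · have hab' : (a : ℝ) + 1 ≤ b := by exact_mod_cast hab
      exact inv_anti₀ (by linarith [h1.1]) (by linarith [h1.2, h2.1])
    · have := rcf_le_of_altLT ht.tail hs.tail h hz hy
      exact inv_anti₀ (by linarith [h1.1]) (by linarith)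
  termination_by s t => s.length + t.length

/-! ### The Gauss map -/

/-- The Gauss map. -/
noncomputable def gauss (x : ℝ) : ℝ := Int.fract x⁻¹

/-- The partial quotients of a number in `(0, 1]`. -/
noncomputable def dig (x : ℝ) (i : ℕ) : ℕ := ⌊(gauss^[i] x)⁻¹⌋₊

theorem gauss_nonneg (x : ℝ) : 0 ≤ gauss x := Int.fract_nonneg _

theorem gauss_lt_one (x : ℝ) : gauss x < 1 := Int.fract_lt_one _

theorem iterate_gauss_mem {x : ℝ} (hx : x ∈ Icc (0 : ℝ) 1) (n : ℕ) :
    gauss^[n] x ∈ Icc (0 : ℝ) 1 := by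
  cases n with
  | zero => exact hx
  | succ n =>
    rw [Function.iterate_succ_apply']
    exact ⟨gauss_nonneg _, (gauss_lt_one _).le⟩

theorem dig_gauss (x : ℝ) (i : ℕ) : dig (gauss x) i = dig x (i + 1) := rfl

theorem dig_iterate (x : ℝ) (m i : ℕ) : dig (gauss^[m] x) i = dig x (m + i) := by
  rw [dig, dig, ← Function.iterate_add_apply, Nat.add_comm]

theorem eq_inv_dig_add {x : ℝ} (hx : 0 ≤ x) : x = ((dig x 0 : ℝ) + gauss x)⁻¹ := by
  have : 0 ≤ x⁻¹ := inv_nonneg.2 hx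
  simp only [dig, Function.iterate_zero, id, gauss]
  rw [natCast_floor_eq_intCast_floor this, Int.floor_add_fract, inv_inv]

theorem one_le_dig {x : ℝ} (h0 : 0 < x) (h1 : x ≤ 1) : 1 ≤ dig x 0 := by
  rw [dig, Nat.one_le_floor_iff]
  exact (one_le_inv₀ h0).2 h1

theorem gauss_inv_add (a : ℕ) {y : ℝ} (h0 : 0 ≤ y) (h1 : y < 1) :
    gauss ((a : ℝ) + y)⁻¹ = y ∧ dig ((a : ℝ) + y)⁻¹ 0 = a := by
  constructor
  · rw [gauss, inv_inv, Int.fract_natCast_add, Int.fract_eq_self.2 ⟨h0, h1⟩]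
  · simp only [dig, Function.iterate_zero, id, inv_inv]
    rw [add_comm, Nat.floor_add_natCast h0, Nat.floor_eq_zero.2 h1, zero_add]

theorem eq_rcf_pre {x : ℝ} (hx : 0 ≤ x) (n : ℕ) : x = rcf (pre (dig x) n) (gauss^[n] x) := by
  induction n generalizing x with
  | zero => rfl
  | succ n ih =>
    rw [pre_cons, rcf, Function.iterate_succ_apply]
    have := ih (gauss_nonneg x)
    rw [show (fun i => dig x (i + 1)) = dig (gauss x) from rfl, ← this]
    exact eq_inv_dig_add hx

theorem drop_pre {β : Type} (w : ℕ → β) (m n : ℕ) :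
    (pre w n).drop m = pre (fun i => w (m + i)) (n - m) := by
  apply List.ext_getElem
  · simp [pre]
  · intro i h1 h2
    simp [pre]

theorem take_pre {β : Type} (w : ℕ → β) (m n : ℕ) (h : m ≤ n) :
    (pre w n).take m = pre w m := by
  apply List.ext_getElem
  · simp [pre, h]
  · intro i h1 h2
    simp [pre]

theorem lt_of_altLT_dig {n : ℕ} {x y : ℝ} (hx : 0 ≤ x) (hy : 0 ≤ y)
    (hp : Pos (pre (dig x) n)) (hq : Pos (pre (dig y) n))
    (h : AltLT (pre (dig x) n) (pre (dig y) n)) : y < x := by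
  induction n generalizing x y with
  | zero => exact absurd h (not_altLT_nil _)
  | succ n ih =>
    rw [pre_cons] at h hp hq
    rw [pre_cons, altLT_cons] at h
    have ex := eq_inv_dig_add hx
    have ey := eq_inv_dig_add hy
    have h1 := hp.head
    have h2 := hq.head
    have gx := gauss_nonneg x
    have gy := gauss_nonneg y
    rw [ex, ey]
    rcases h with ⟨-, h⟩ | ⟨he, h⟩
    · have h' : (dig x 0 : ℝ) + 1 ≤ dig y 0 := by exact_mod_cast h
      exact inv_strictAnti₀ (by linarith) (by linarith [gauss_lt_one x])
    · have := ih gy gx hq.tail hp.tail h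
      rw [he] at h1 ⊢
      exact inv_strictAnti₀ (by linarith) (by linarith)

/-- Digits and Gauss orbit of a finite continued fraction. -/
theorem rcf_orbit {s : List ℕ} {y : ℝ}
    (h : ∀ m, 1 ≤ m → m ≤ s.length → 0 ≤ rcf (s.drop m) y ∧ rcf (s.drop m) y < 1) :
    pre (dig (rcf s y)) s.length = s ∧
      ∀ m ≤ s.length, gauss^[m] (rcf s y) = rcf (s.drop m) y := by
  induction s with
  | nil => simp [pre]
  | cons a s ih =>
    have h1 := h 1 le_rfl (by simp)
    simp only [List.drop_succ_cons, List.drop_zero] at h1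
    obtain ⟨i1, i2⟩ := ih (fun m hm hm' => by simpa using h (m + 1) (by omega) (by simpa using hm'))
    obtain ⟨g1, g2⟩ := gauss_inv_add a h1.1 h1.2
    refine ⟨?_, ?_⟩
    · rw [List.length_cons, pre_cons]
      have : (fun i => dig (rcf (a :: s) y) (i + 1)) = dig (rcf s y) := by
        funext i
        rw [← dig_gauss]
        simp only [rcf]
        rw [g1]
      rw [this, i1]
      simp only [rcf, g2]
    · intro m hm
      cases m with
      | zero => rfl
      | succ m =>
        rw [Function.iterate_succ_apply, List.drop_succ_cons]
        simp only [rcf]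
        rw [g1]
        exact i2 m (by simpa using hm)


/-! ### Sequences that are minimal among their suffixes -/

/-- Each proper suffix is at most the prefix of the same length in the alternating order, and
different from it if its length is even. -/
def Admissible (s : List ℕ) : Prop := ∀ m, 1 ≤ m → m < s.length →
  AltLE (s.drop m) (s.take (s.length - m)) ∧
    (Even (s.length - m) → s.drop m ≠ s.take (s.length - m))

/-- The number `[0; a₁, …, aₙ]` is smaller than `[0; aₘ, …, aₙ]` for `m ≥ 2`. -/
def SuffixMinimal (s : List ℕ) : Prop := ∀ m, 1 ≤ m → m < s.length →
  rcf s 0 < rcf (s.drop m) 0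

/-- Numerator and denominator of `[0; a₁, …, aₙ]`. -/
def fraction : List ℕ → ℕ × ℕ
  | [] => (0, 1)
  | a :: s => ((fraction s).2, a * (fraction s).2 + (fraction s).1)

theorem fraction_coprime (s : List ℕ) : Nat.Coprime (fraction s).1 (fraction s).2 := by
  induction s with
  | nil => simp [fraction]
  | cons a s ih =>
    simp only [fraction]
    rw [Nat.coprime_mul_right_add_right]
    exact ih.symm

theorem fraction_snd_pos {s : List ℕ} (hs : Pos s) : 0 < (fraction s).2 := by
  induction s with
  | nil => simp [fraction]
  | cons a s ih =>
    have := ih hs.tail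
    have h : 1 ≤ a := hs a (by simp)
    simp only [fraction]
    positivity

theorem rcf_zero_eq_fraction {s : List ℕ} (hs : Pos s) :
    rcf s 0 = ((fraction s).1 : ℝ) / (fraction s).2 := by
  induction s with
  | nil => simp [rcf, fraction]
  | cons a s ih =>
    have h := fraction_snd_pos hs.tail
    have h' : (0 : ℝ) < (fraction s).2 := by exact_mod_cast h
    simp only [rcf, ih hs.tail, fraction]
    push_cast
    rw [← inv_div]
    field_simp

theorem fraction_snd_cons {a : ℕ} {s : List ℕ} (hs : Pos (a :: s)) :
    (fraction s).2 ≤ (fraction (a :: s)).2 ∧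
      (s ≠ [] → (fraction s).2 < (fraction (a :: s)).2) := by
  have h : 1 ≤ a := hs a (by simp)
  simp only [fraction]
  have h1 : (fraction s).2 ≤ a * (fraction s).2 := Nat.le_mul_of_pos_left _ h
  refine ⟨by omega, fun hne => ?_⟩
  cases s with
  | nil => exact absurd rfl hne
  | cons b s =>
    have : 0 < (fraction (b :: s)).1 := fraction_snd_pos hs.tail.tail
    omega

theorem fraction_snd_drop_lt {s : List ℕ} (hs : Pos s) (m : ℕ) (h1 : 1 ≤ m)
    (hm : m < s.length) : (fraction (s.drop m)).2 < (fraction s).2 := by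
  induction s generalizing m with
  | nil => simp at hm
  | cons a s ih =>
    obtain ⟨m, rfl⟩ := Nat.exists_eq_add_of_le' h1
    rw [List.drop_succ_cons]
    have hm' : m < s.length := by simpa using hm
    cases m with
    | zero => exact (fraction_snd_cons hs).2 (List.ne_nil_of_length_pos hm')
    | succ m => exact (ih hs.tail _ (by omega) hm').trans_le (fraction_snd_cons hs).1

/-- Both values are reduced fractions, and removing leading terms strictly lowers the denominator.
-/
theorem rcf_drop_zero_ne {s : List ℕ} (hs : Pos s) (m : ℕ) (h1 : 1 ≤ m)
    (hm : m < s.length) : rcf (s.drop m) 0 ≠ rcf s 0 := by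
  intro h
  have hlt := fraction_snd_drop_lt hs m h1 hm
  have p1 := fraction_snd_pos hs
  have p2 := fraction_snd_pos (hs.drop m)
  rw [rcf_zero_eq_fraction hs, rcf_zero_eq_fraction (hs.drop m), div_eq_div_iff
    (by exact_mod_cast p2.ne') (by exact_mod_cast p1.ne')] at h
  have h' : (fraction (s.drop m)).1 * (fraction s).2 =
      (fraction s).1 * (fraction (s.drop m)).2 := by exact_mod_cast h
  have hd : (fraction s).2 ∣ (fraction s).1 * (fraction (s.drop m)).2 := Dvd.intro_left _ h'
  exact absurd (Nat.le_of_dvd p2 ((fraction_coprime s).symm.dvd_of_dvd_mul_left hd)) (by omega)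

theorem rcf_take_drop (s : List ℕ) (k : ℕ) (y : ℝ) :
    rcf s y = rcf (s.take k) (rcf (s.drop k) y) := by
  rw [← rcf_append, List.take_append_drop]

theorem length_drop_take (s : List ℕ) (m : ℕ) :
    (s.drop m).length = (s.take (s.length - m)).length := by
  simp

/-- A strict alternating inequality gives ≤ for the values, and the denominators exclude equality.
If the suffix equals a prefix, its length is odd, and the positive remainder after that prefix
lowers the value. With the converse below, admissibility becomes a condition on values, which can be
transferred between the two expansions of a rational number. -/
theorem Admissible.suffixMinimal {s : List ℕ} (hs : Pos s) (h : Admissible s) :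
    SuffixMinimal s := by
  intro m h1 hm
  obtain ⟨ha, hb⟩ := h m h1 hm
  have h0 : (0 : ℝ) ∈ Icc (0 : ℝ) 1 := by simp
  rw [rcf_take_drop s (s.length - m) 0]
  rcases ha with ha | ha
  · apply lt_of_le_of_ne
    · exact rcf_le_of_altLT (hs.drop m) (hs.take _) ha h0 (rcf_mem_Icc (hs.drop _) h0)
    · rw [← rcf_take_drop]
      exact (rcf_drop_zero_ne hs m h1 hm).symm
  · have hodd : ¬ Even (s.length - m) := fun he => hb he ha
    rw [ha]
    apply rcf_lt_of_not_even (hs.take _) (by norm_num)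
    · apply rcf_pos (hs.drop _) _ (by norm_num)
      apply List.ne_nil_of_length_pos
      simp
      omega
    · rwa [List.length_take, min_eq_left (by omega)]

theorem SuffixMinimal.admissible {s : List ℕ} (hs : Pos s) (h : SuffixMinimal s) :
    Admissible s := by
  intro m h1 hm
  have ha := h m h1 hm
  have h0 : (0 : ℝ) ∈ Icc (0 : ℝ) 1 := by simp
  rw [rcf_take_drop s (s.length - m) 0] at ha
  constructor
  · rcases altLT_trichotomy _ _ (length_drop_take s m) with h2 | h2 | h2
    · exact Or.inl h2
    · exact Or.inr h2
    · exact absurd (rcf_le_of_altLT (hs.take _) (hs.drop m) h2 (rcf_mem_Icc (hs.drop _) h0) h0)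
        (not_le.2 ha)
  · intro he heq
    rw [heq] at ha
    refine lt_asymm ha (rcf_lt_of_even (hs.take _) (by norm_num) ?_ ?_)
    · apply rcf_pos (hs.drop _) _ (by norm_num)
      apply List.ne_nil_of_length_pos
      simp
      omega
    · rwa [List.length_take, min_eq_left (by omega)]

/-- If `α = [0; a₁, …, aₙ + y]` with `0 ≤ y < α` for an admissible sequence, then all numbers
`[0; aₘ, …, aₙ + y]` are at least `α`. -/
theorem Admissible.le_rcf_drop {s : List ℕ} (hs : Pos s) (h : Admissible s) {y : ℝ}
    (h0 : 0 ≤ y) (hy : y < rcf s y) (m : ℕ) (hm : m < s.length) :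
    rcf s y ≤ rcf (s.drop m) y := by
  have hne : s ≠ [] := List.ne_nil_of_length_pos (by omega)
  have hy1 : y ∈ Icc (0 : ℝ) 1 := ⟨h0, hy.le.trans (rcf_le_one hs hne h0)⟩
  have alt : ∀ k, 1 ≤ k → k < s.length →
      rcf s y ≤ rcf (s.drop k) y ∨
        (s.drop k = s.take (s.length - k) ∧ ¬ Even (s.length - k)) := by
    intro k hk hk'
    obtain ⟨ha, hb⟩ := h k hk hk'
    rcases ha with ha | ha
    · left
      rw [rcf_take_drop s (s.length - k) y]
      exact rcf_le_of_altLT (hs.drop k) (hs.take _) ha hy1 (rcf_mem_Icc (hs.drop _) hy1)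
    · exact Or.inr ⟨ha, fun he => hb he ha⟩
  rcases Nat.eq_zero_or_pos m with rfl | hm0
  · simp
  by_contra hlt
  rw [not_le] at hlt
  obtain ⟨e1, o1⟩ := (alt m hm0 hm).resolve_left (not_le.2 hlt)
  set k := s.length - m with hk
  have f0 := rcf_nonneg (hs.drop m) h0
  have g0 := rcf_nonneg (hs.drop k) h0
  -- The prefix of length `k` is decreasing and maps `rcf (s.drop k) y` to `rcf s y`, but `y` to the
  -- smaller number `rcf (s.drop m) y`.
  have c1 : rcf (s.drop k) y < y := by
    by_contra hge
    rw [not_lt] at hge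
    rcases hge.eq_or_lt with he | hl
    · rw [rcf_take_drop s k y, ← he, e1] at hlt
      exact lt_irrefl _ hlt
    · have := rcf_lt_of_not_even (hs.take k) (by linarith) hl
        (by rwa [List.length_take, min_eq_left (by omega)])
      rw [← rcf_take_drop, ← e1] at this
      exact lt_asymm this hlt
  obtain ⟨e2, -⟩ := (alt k (by omega) (by omega)).resolve_left (not_le.2 (c1.trans hy))
  have hkm : s.length - k = m := by omega
  rw [hkm] at e2
  -- Now the suffixes at `m` and `k` both violate the bound. Writing α = `rcf s y`, p = `rcf (s.drop
  -- m) y` and q = `rcf (s.drop k) y`, contraction gives |α - p| ≤ |q - y| and |α - q| ≤ |p - y|,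
  -- which is incompatible with p < α and q < y < α.
  have d1 := (abs_rcf_sub_le (hs.take k) g0 h0).1
  rw [← rcf_take_drop, ← e1] at d1
  have d2 := (abs_rcf_sub_le (hs.take m) f0 h0).1
  rw [← rcf_take_drop, ← e2] at d2
  have d1' := (le_abs_self _).trans d1
  have d2' := (le_abs_self _).trans d2
  rw [abs_of_neg (by linarith)] at d1'
  rcases abs_cases (rcf (s.drop m) y - y) with ⟨h3, -⟩ | ⟨h3, -⟩ <;> rw [h3] at d2' <;> linarith

/-! ### The two continued fractions of a rational number -/

/-- The sequences `a₁ ⋯ aₙ₋₁ (aₙ + 1)` and `a₁ ⋯ aₙ₋₁ aₙ 1`, in any order. -/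
def AltPair (s s' : List ℕ) : Prop := ∃ t a, 1 ≤ a ∧
  ((s = t ++ [a + 1] ∧ s' = t ++ [a, 1]) ∨ (s = t ++ [a, 1] ∧ s' = t ++ [a + 1]))

theorem AltPair.symm {s s' : List ℕ} (h : AltPair s s') : AltPair s' s := by
  obtain ⟨t, a, ha, h⟩ := h
  exact ⟨t, a, ha, by tauto⟩

theorem exists_altPair {s : List ℕ} (hs : Pos s) (hne : s ≠ []) (h1 : s ≠ [1]) :
    ∃ s', AltPair s s' := by
  rcases List.eq_nil_or_concat s with rfl | ⟨t, b, rfl⟩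
  · exact absurd rfl hne
  rw [List.concat_eq_append] at *
  have hb : 1 ≤ b := hs b (by simp)
  obtain ⟨c, rfl⟩ := Nat.exists_eq_add_of_le' hb
  cases c with
  | succ c => exact ⟨_, t, c + 1, by omega, Or.inl ⟨rfl, rfl⟩⟩
  | zero =>
    rcases List.eq_nil_or_concat t with rfl | ⟨t, a, rfl⟩
    · simp at h1
    · have ha : 1 ≤ a := hs a (by simp)
      exact ⟨_, t, a, ha, Or.inr ⟨by simp, rfl⟩⟩

theorem AltPair.pos {s s' : List ℕ} (h : AltPair s s') (hs : Pos s) : Pos s' := by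
  obtain ⟨t, a, ha, ⟨rfl, rfl⟩ | ⟨rfl, rfl⟩⟩ := h
  all_goals
    intro b hb
    simp only [List.mem_append, List.mem_cons, List.not_mem_nil, or_false] at hb
    rcases hb with hb | hb
    · exact hs b (by simp [hb])
    · omega

theorem AltPair.even_iff {s s' : List ℕ} (h : AltPair s s') :
    Even s'.length ↔ ¬ Even s.length := by
  obtain ⟨t, a, ha, ⟨rfl, rfl⟩ | ⟨rfl, rfl⟩⟩ := h <;> simp [Nat.even_add_one]

theorem AltPair.ne_nil {s s' : List ℕ} (h : AltPair s s') : s' ≠ [] := by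
  obtain ⟨t, a, ha, ⟨rfl, rfl⟩ | ⟨rfl, rfl⟩⟩ := h <;> simp

theorem AltPair.eq_of {s s' s'' : List ℕ} (h : AltPair s s') (h' : AltPair s s'') :
    s' = s'' := by
  obtain ⟨t, a, ha, h⟩ := h
  obtain ⟨u, b, hb, h'⟩ := h'
  rcases h with ⟨rfl, rfl⟩ | ⟨rfl, rfl⟩ <;> rcases h' with ⟨h1, rfl⟩ | ⟨h1, rfl⟩
  · obtain ⟨rfl, h⟩ := List.append_inj' h1 rfl
    simp at h
    simp [h]
  · rw [show u ++ [b, 1] = (u ++ [b]) ++ [1] by simp] at h1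
    have := (List.append_inj' h1 rfl).2
    simp at this
    omega
  · rw [show t ++ [a, 1] = (t ++ [a]) ++ [1] by simp] at h1
    have := (List.append_inj' h1 rfl).2
    simp at this
    omega
  · obtain ⟨rfl, h⟩ := List.append_inj' h1 rfl
    simp at h
    simp [h]

/-- Passing to the other expansion changes the tail by the involution z ↦ 1/(1 + z) - 1. It fixes 0,
exchanges negative and positive tails, and is the relation between the two orbits in `merge`. -/
theorem AltPair.rcf_eq {s s' : List ℕ} (h : AltPair s s') {z : ℝ} (hz : -1 < z) :
    rcf s z = rcf s' (1 / (1 + z) - 1) := by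
  obtain ⟨t, a, ha, ⟨rfl, rfl⟩ | ⟨rfl, rfl⟩⟩ := h
  · rw [rcf_append, rcf_append]
    congr 1
    simp only [rcf]
    congr 1
    push_cast
    have : 1 + z ≠ 0 := by linarith
    field_simp
    ring
  · rw [rcf_append, rcf_append]
    congr 1
    simp only [rcf]
    congr 1
    push_cast
    rw [one_div]
    ring

theorem AltPair.rcf_zero_lt_one {s s' : List ℕ} (h : AltPair s s') (hs : Pos s) :
    rcf s 0 < 1 := by
  have key : ∀ t a, Pos t → 1 ≤ a → rcf (t ++ [a + 1]) 0 < 1 := by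
    intro t a ht ha
    have ha' : (1 : ℝ) ≤ a := by exact_mod_cast ha
    cases t with
    | nil =>
      simp only [List.nil_append, rcf]
      apply inv_lt_one_of_one_lt₀
      push_cast
      linarith
    | cons b t =>
      simp only [List.cons_append, rcf]
      apply inv_lt_one_of_one_lt₀
      have := ht.head
      have h2 : 0 < rcf (t ++ [a + 1]) 0 := by
        apply rcf_pos _ (by simp) (by norm_num)
        intro c hc
        simp only [List.mem_append, List.mem_singleton] at hc
        rcases hc with hc | hc
        · exact ht.tail c hc
        · omega
      linarith
  have h' := h
  obtain ⟨t, a, ha, ⟨rfl, rfl⟩ | ⟨rfl, rfl⟩⟩ := h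
  · exact key t a (fun b hb => hs b (by simp [hb])) ha
  · rw [h'.rcf_eq (by norm_num)]
    norm_num
    exact key t a (fun b hb => hs b (by simp [hb])) ha

/-- Removing terms from both members of a pair, as long as it makes sense; what remains is the
single term `1`. -/
theorem AltPair.drop {s s' : List ℕ} (h : AltPair s s') (m : ℕ) (hm : m < s'.length) :
    (AltPair (s.drop m) (s'.drop m) ∧ m < s.length) ∨ s'.drop m = [1] := by
  obtain ⟨t, a, ha, h⟩ := h
  by_cases hmt : m ≤ t.length
  · left
    refine ⟨⟨t.drop m, a, ha, ?_⟩, ?_⟩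
    · rcases h with ⟨rfl, rfl⟩ | ⟨rfl, rfl⟩
      · exact Or.inl (by simp [List.drop_append_of_le_length hmt])
      · exact Or.inr (by simp [List.drop_append_of_le_length hmt])
    · rcases h with ⟨rfl, rfl⟩ | ⟨rfl, rfl⟩ <;> simp <;> omega
  · right
    rcases h with ⟨rfl, rfl⟩ | ⟨rfl, rfl⟩
    · simp at hm
      obtain rfl : m = t.length + 1 := by omega
      rw [show t ++ [a, 1] = (t ++ [a]) ++ [1] by simp]
      exact List.drop_left' (by simp)
    · simp at hm
      omega

/-- Corresponding suffixes have equal values at the tail 0. The only suffix without a counterpart is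
the single term 1, and its value 1 is larger than that of the whole sequence. -/
theorem AltPair.suffixMinimal {s s' : List ℕ} (h : AltPair s s') (hs : Pos s)
    (hm : SuffixMinimal s) : SuffixMinimal s' := by
  intro m h1 hl
  have e : ∀ {p p' : List ℕ}, AltPair p p' → rcf p' 0 = rcf p 0 := by
    intro p p' hp
    have := hp.rcf_eq (z := 0) (by norm_num)
    norm_num at this
    exact this.symm
  rw [e h]
  rcases h.drop m hl with ⟨h2, h3⟩ | h2
  · rw [e h2]
    exact hm m h1 h3
  · rw [h2]
    simpa [rcf] using h.rcf_zero_lt_one hs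

theorem AltPair.admissible {s s' : List ℕ} (h : AltPair s s') (hs : Pos s)
    (hm : Admissible s) : Admissible s' :=
  (h.suffixMinimal hs (hm.suffixMinimal hs)).admissible (h.pos hs)

/-! ### The labels -/

theorem two_mem_Aminus : two ∈ Aminus := ⟨2, le_rfl, rfl⟩

theorem wordOfChar_mem : ∀ (s : List ℕ), ∀ x ∈ wordOfChar s, x ∈ Aminus
  | [], x, h => by simp [wordOfChar] at h
  | [a], x, h => by
    simp only [wordOfChar, List.mem_replicate] at h
    exact h.2 ▸ two_mem_Aminus
  | a :: b :: s, x, h => by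
    simp only [wordOfChar, List.mem_append, List.mem_replicate, List.mem_cons] at h
    rcases h with h | h | h
    · exact h.2 ▸ two_mem_Aminus
    · exact ⟨2 + b, by omega, h⟩
    · exact wordOfChar_mem s x h

/-- The total length is odd, so the strict inequalities in `F` are exactly those for the suffixes of
even length. -/
theorem F.admissible {v : List Letter} (hv : v ∈ F) : Admissible (charWord v) := by
  obtain ⟨ℓ, hl⟩ := (charWord_spec v hv.1).1
  intro m h1 hm
  have hF := hv.2 ℓ hl
  rcases Nat.even_or_odd' m with ⟨j, rfl | rfl⟩
  · obtain ⟨-, h3⟩ := hF j (by omega) (by omega)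
    have e : (charWord v).length - 2 * j = 2 * ℓ - 2 * j + 1 := by omega
    rw [e]
    refine ⟨h3, fun h => absurd h ?_⟩
    rw [Nat.not_even_iff_odd]
    exact ⟨ℓ - j, by omega⟩
  · obtain ⟨h2, -⟩ := hF (j + 1) (by omega) (by omega)
    have e : (charWord v).length - (2 * j + 1) = 2 * ℓ - 2 * (j + 1) + 2 := by omega
    have e' : 2 * (j + 1) - 1 = 2 * j + 1 := by omega
    rw [e'] at h2
    rw [e]
    refine ⟨Or.inl h2, fun _ heq => ?_⟩
    obtain ⟨-, i, -, -, hi⟩ := h2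
    rw [heq] at hi
    split_ifs at hi <;> exact lt_irrefl _ hi

theorem wordOfChar_mem_F {s : List ℕ} (hs : Pos s) (hodd : Odd s.length)
    (h : Admissible s) : wordOfChar s ∈ F := by
  refine ⟨wordOfChar_mem s, ?_⟩
  rw [charWord_unique s hodd hs]
  intro ℓ hl j h1 hj
  have a1 := h (2 * j - 1) (by omega) (by omega)
  have a2 := h (2 * j) (by omega) (by omega)
  have e1 : s.length - (2 * j - 1) = 2 * ℓ - 2 * j + 2 := by omega
  have e2 : s.length - 2 * j = 2 * ℓ - 2 * j + 1 := by omega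
  rw [e1] at a1
  rw [e2] at a2
  exact ⟨a1.1.resolve_right (a1.2 ⟨ℓ - j + 1, by omega⟩), a2.1⟩


/-! ### By-excess continued fractions in terms of regular ones -/

/-- In the coordinate 1/(1 + y) the letter (-1:2) acts as translation by 1. -/
theorem cfWord_replicate_two (k : ℕ) (w : List Letter) {x : ℝ} (h : 0 < 1 + cfWord w x) :
    1 + cfWord (List.replicate k two ++ w) x = 1 / (k + 1 / (1 + cfWord w x)) := by
  induction k with
  | zero => simp
  | succ k ih =>
    rw [List.replicate_succ, List.cons_append]
    have e : cfWord (List.replicate k two ++ w) x = 1 / (k + 1 / (1 + cfWord w x)) - 1 := by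
      linarith
    simp only [two] at e ⊢
    simp only [cfWord, e]
    have h1 : 0 < 1 / (1 + cfWord w x) := by positivity
    set q := 1 / (1 + cfWord w x)
    have h2 : 0 < (k : ℝ) + q := by positivity
    push_cast
    have h3 : (2 : ℝ) + (1 / (k + q) - 1) = (k + 1 + q) / (k + q) := by
      field_simp
      ring
    have h4 : (k : ℝ) + 1 + q ≠ 0 := by linarith
    rw [h3]
    field_simp
    ring

theorem cfWord_wordOfChar_step {a b : ℕ} {s : List ℕ} (hs : Pos (a :: b :: s)) {x R : ℝ}
    (hR : -1 < R) (h : 1 + cfWord (wordOfChar s) x = R) :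
    1 + cfWord (wordOfChar (a :: b :: s)) x = ((a : ℝ) + ((b : ℝ) + R)⁻¹)⁻¹ := by
  have ha : 1 ≤ a := hs a (by simp)
  have hb := hs.tail.head
  have e : cfWord (wordOfChar s) x = R - 1 := by linarith
  have h3 : 0 < (b : ℝ) + R := by linarith
  have h2 : 0 < (1 : ℝ) + b + R := by linarith
  have e1 : 1 + cfWord (Letter.fin (-1) (2 + b) :: wordOfChar s) x =
      (b + R) / (1 + b + R) := by
    simp only [cfWord, e]
    push_cast
    have : (2 : ℝ) + b + (R - 1) ≠ 0 := by linarith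
    field_simp
    ring
  rw [wordOfChar, cfWord_replicate_two _ _ (by rw [e1]; positivity), e1, Nat.cast_sub ha]
  rw [one_div]
  congr 1
  push_cast
  field_simp
  ring

/-- Two terms of `s` make one block, a run of (-1:2) closed by another letter, after which the tail
is again 1 + x. At odd length the last run is left open, so the tail appears as 1/(1 + x); the -1 is
due to a run having one letter less than its term. -/
theorem cfWord_wordOfChar_of_odd : ∀ {s : List ℕ}, Pos s → ¬ Even s.length → ∀ {x : ℝ}, -1 < x →
    1 + cfWord (wordOfChar s) x = rcf s (1 / (1 + x) - 1)
  | [], _, h, _, _ => by simp at h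
  | [a], hs, _, x, hx => by
    have ha : 1 ≤ a := hs a (by simp)
    have := cfWord_replicate_two (a - 1) [] (x := x) (by simp only [cfWord]; linarith)
    rw [List.append_nil] at this
    simp only [wordOfChar, rcf, this, cfWord, Nat.cast_sub ha]
    rw [one_div]
    congr 1
    push_cast
    ring
  | a :: b :: s, hs, ho, x, hx => by
    have hpos : 0 < 1 / (1 + x) := one_div_pos.2 (by linarith)
    exact cfWord_wordOfChar_step hs (rcf_gt hs.tail.tail (by linarith)).1
      (cfWord_wordOfChar_of_odd hs.tail.tail (by simpa [Nat.even_add_one] using ho) hx)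

theorem cfWord_wordOfChar_of_even : ∀ {s : List ℕ}, Pos s → Even s.length → ∀ {x : ℝ}, -2 < x →
    1 + cfWord (wordOfChar s) x = rcf s (1 + x)
  | [], _, _, _, _ => rfl
  | [a], _, h, _, _ => by simp at h
  | a :: b :: s, hs, ho, x, hx =>
    cfWord_wordOfChar_step hs (rcf_gt hs.tail.tail (by linarith)).1
      (cfWord_wordOfChar_of_even hs.tail.tail (by simpa [Nat.even_add_one] using ho) hx)

/-- The hat operation exchanges the roles of odd and even places, so beyond the first letter it is a
shift of the characteristic sequence. -/
theorem hatOfChar_cons : ∀ (a : ℕ) (t : List ℕ),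
    hatOfChar (a :: t) = Letter.fin (-1) (2 + a) :: wordOfChar t
  | a, [] => rfl
  | a, [b] => by simp [hatOfChar, wordOfChar]
  | a, b :: c :: t => by rw [hatOfChar, hatOfChar_cons c t, wordOfChar]

theorem cfWord_hatOfChar {s : List ℕ} (hs : Pos s) (ho : ¬ Even s.length) {x : ℝ}
    (hx : -1 < x) : 1 + cfWord (hatOfChar s) x = 1 / (1 + rcf s (1 + x)) := by
  cases s with
  | nil => simp at ho
  | cons a t =>
    have ht : Even t.length := by simpa [Nat.even_add_one] using ho
    have h := cfWord_wordOfChar_of_even hs.tail ht (x := x) (by linarith)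
    have e : cfWord (wordOfChar t) x = rcf t (1 + x) - 1 := by linarith
    have ha := hs.head
    have h1 := rcf_nonneg hs.tail (y := 1 + x) (by linarith)
    rw [hatOfChar_cons a t]
    simp only [cfWord, rcf, e]
    push_cast
    set R := rcf t (1 + x)
    have h2 : (2 : ℝ) + a + (R - 1) ≠ 0 := by linarith
    have h3 : (a : ℝ) + R ≠ 0 := by linarith
    have h4 : (1 : ℝ) + a + R ≠ 0 := by linarith
    have h5 : 1 + ((a : ℝ) + R)⁻¹ = (1 + a + R) / (a + R) := by
      field_simp
      ring
    rw [h5]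
    field_simp
    ring

theorem cfWord_wordShift (k : ℤ) : ∀ (v : List Letter), (∀ x ∈ v, x ∈ Aminus) → v ≠ [] →
    ∀ y : ℝ, cfWord (wordShift k v) y = cfWord v (y + k)
  | [], _, h, _ => absurd rfl h
  | [a], hv, _, y => by
    obtain ⟨d, -, rfl⟩ := hv a (by simp)
    simp only [wordShift, Letter.shift, cfWord]
    push_cast
    congr 1
    ring
  | a :: b :: v, hv, _, y => by
    have ih := cfWord_wordShift k (b :: v) (fun x hx => hv x (List.mem_cons_of_mem _ hx))
      (by simp) y
    obtain ⟨d, -, rfl⟩ := hv a (by simp)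
    rw [wordShift, cfWord, ih, ← cfWord]

theorem hatOfChar_mem : ∀ (s : List ℕ), ∀ x ∈ hatOfChar s, x ∈ Aminus
  | [], x, h => by simp [hatOfChar] at h
  | [a], x, h => by
    simp only [hatOfChar, List.mem_singleton] at h
    exact ⟨2 + a, by omega, h⟩
  | a :: b :: s, x, h => by
    simp only [hatOfChar, List.mem_append, List.mem_replicate, List.mem_cons] at h
    rcases h with h | h | h
    · exact ⟨2 + a, by omega, h⟩
    · exact h.2 ▸ two_mem_Aminus
    · exact hatOfChar_mem s x h

/-! ### Periodic words -/

theorem pre_add {β : Type} (w : ℕ → β) (m n : ℕ) :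
    pre w (m + n) = pre w m ++ pre (fun i => w (m + i)) n := by
  simp [pre, List.range_add, Function.comp_def]

theorem pre_periodic (w : List Letter) : pre (periodic w) w.length = w := by
  apply List.ext_getElem
  · simp [pre]
  · intro i h1 h2
    simp [pre, periodic, Nat.mod_eq_of_lt h2, h2]

theorem periodic_mem {w : List Letter} (hw : ∀ x ∈ w, x ∈ Aminus) (hne : w ≠ []) (n : ℕ) :
    periodic w n ∈ Aminus := by
  have : n % w.length < w.length := Nat.mod_lt _ (List.length_pos_iff.2 hne)
  rw [periodic, List.getD_eq_getElem _ _ this]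
  exact hw _ (List.getElem_mem _)

theorem continuousAt_cfWord {w : List Letter} (hw : ∀ x ∈ w, x ∈ Aminus) {y : ℝ} (h1 : -1 ≤ y)
    (h0 : y ≤ 0) : ContinuousAt (cfWord w) y := by
  induction w with
  | nil => exact continuousAt_id
  | cons a w ih =>
    have hw' : ∀ x ∈ w, x ∈ Aminus := fun x hx => hw x (List.mem_cons_of_mem _ hx)
    obtain ⟨d, hd, rfl⟩ := hw a (by simp)
    have hd' : (2 : ℝ) ≤ d := by exact_mod_cast hd
    have := (cfWord_mem w hw' y h1 h0).1
    exact continuousAt_const.div (continuousAt_const.add (ih hw')) (by linarith)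

theorem cfWord_eq_neg_one {w : List Letter} (hw : ∀ x ∈ w, x ∈ Aminus) {y : ℝ} (h1 : -1 ≤ y)
    (h0 : y ≤ 0) (h : cfWord w y = -1) : ∀ x ∈ w, x = two := by
  induction w with
  | nil => simp
  | cons a w ih =>
    have hw' : ∀ x ∈ w, x ∈ Aminus := fun x hx => hw x (List.mem_cons_of_mem _ hx)
    obtain ⟨d, hd, rfl⟩ := hw a (by simp)
    have hd' : (2 : ℝ) ≤ d := by exact_mod_cast hd
    have hm := (cfWord_mem w hw' y h1 h0).1
    simp only [cfWord] at h
    rw [div_eq_iff (by linarith)] at h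
    push_cast at h
    have hd2 : (d : ℝ) = 2 := by linarith
    have hd3 : d = 2 := by exact_mod_cast hd2
    intro x hx
    rcases List.mem_cons.1 hx with rfl | hx
    · rw [hd3]
      rfl
    · exact ih hw' (by linarith) x hx

/-- The limit is a fixed point by continuity. It is not -1, since a word over `Aminus` takes the
value -1 only if all its letters are (-1:2). -/
theorem cfStream_periodic {w : List Letter} (hw : ∀ x ∈ w, x ∈ Aminus)
    (h2 : ∃ x ∈ w, x ≠ two) : -1 < cfStream (periodic w) ∧ cfStream (periodic w) ≤ 0 ∧
      cfWord w (cfStream (periodic w)) = cfStream (periodic w) := by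
  have hne : w ≠ [] := by
    rintro rfl
    simp at h2
  have ht := tendsto_cfStream (periodic w) (periodic_mem hw hne)
  set z := cfStream (periodic w)
  have hp : ∀ n, ∀ x ∈ pre (periodic w) n, x ∈ Aminus := by
    intro n x hx
    simp only [pre, List.mem_map] at hx
    obtain ⟨i, -, rfl⟩ := hx
    exact periodic_mem hw hne i
  have hm := fun n => cfWord_mem _ (hp n) 0 (by norm_num) le_rfl
  have h1 : -1 ≤ z := ge_of_tendsto' ht fun n => (hm n).1
  have h0 : z ≤ 0 := le_of_tendsto' ht fun n => (hm n).2
  have hfix : cfWord w z = z := by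
    have e : ∀ n, cfWord (pre (periodic w) (n + w.length)) 0 =
        cfWord w (cfWord (pre (periodic w) n) 0) := by
      intro n
      rw [Nat.add_comm, pre_add, pre_periodic, cfWord_append _ _ hw]
      congr 3
      funext i
      simp [periodic]
    have l1 := (continuousAt_cfWord hw h1 h0).tendsto.comp ht
    have l2 := ht.comp (tendsto_add_atTop_nat w.length)
    refine tendsto_nhds_unique l1 (l2.congr ?_)
    exact e
  refine ⟨lt_of_le_of_ne h1 fun h => ?_, h0, hfix⟩
  obtain ⟨x, hx, hx2⟩ := h2
  exact hx2 (cfWord_eq_neg_one hw h1 h0 (hfix.trans h.symm) x hx)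

/-! ### The end points of the intervals -/

theorem charWord_pos {v : List Letter} (hv : ∀ x ∈ v, x ∈ Aminus) : Pos (charWord v) :=
  (charWord_spec v hv).2.1

theorem charWord_not_even {v : List Letter} (hv : ∀ x ∈ v, x ∈ Aminus) :
    ¬ Even (charWord v).length :=
  Nat.not_even_iff_odd.2 (charWord_spec v hv).1

theorem charWord_ne_nil {v : List Letter} (hv : ∀ x ∈ v, x ∈ Aminus) : charWord v ≠ [] := by
  intro h
  have := charWord_not_even hv
  simp [h] at this

theorem charWord_ne_one {v : List Letter} (hv : ∀ x ∈ v, x ∈ Aminus) (hne : v ≠ []) :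
    charWord v ≠ [1] := by
  intro h
  have := (charWord_spec v hv).2.2
  rw [h] at this
  exact hne (by simpa [wordOfChar] using this.symm)

theorem hat_eq {v : List Letter} (hv : ∀ x ∈ v, x ∈ Aminus) : ∃ a t, charWord v = a :: t ∧
    Even t.length ∧ hat v = Letter.fin (-1) (2 + a) :: wordOfChar t := by
  have h := charWord_not_even hv
  rw [hat]
  match charWord v, h with
  | [], h => simp at h
  | a :: t, h =>
    have ht : Even t.length := by simpa [Nat.even_add_one] using h
    exact ⟨a, t, rfl, ht, hatOfChar_cons a t⟩

theorem rcf_ζ {v : List Letter} (hv : ∀ x ∈ v, x ∈ Aminus) :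
    0 < ζ v ∧ rcf (charWord v) (ζ v) = ζ v := by
  have hs := charWord_pos hv
  have ho := charWord_not_even hv
  have hm : ∀ x ∈ v ++ hat v, x ∈ Aminus := by
    intro x hx
    rcases List.mem_append.1 hx with hx | hx
    · exact hv x hx
    · exact hatOfChar_mem _ x hx
  obtain ⟨h1, -, h3⟩ := cfStream_periodic hm (by
    obtain ⟨a, t, hat, -, he⟩ := hat_eq hv
    refine ⟨Letter.fin (-1) (2 + a), by simp [he], ?_⟩
    have : 1 ≤ a := hs a (by simp [hat])
    intro h
    simp only [two, Letter.fin.injEq] at h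
    omega)
  rw [ζ]
  set z := cfStream (periodic (v ++ hat v))
  have hz : 0 < z + 1 := by linarith
  refine ⟨hz, ?_⟩
  rw [cfWord_append _ _ hv] at h3
  have e1 := cfWord_hatOfChar hs ho h1
  change 1 + cfWord (hat v) z = _ at e1
  have hβ := rcf_pos hs (charWord_ne_nil hv) (y := 1 + z) (by linarith)
  have e2 := cfWord_wordOfChar_of_odd hs ho (x := cfWord (hat v) z) (by
    have : 0 < 1 / (1 + rcf (charWord v) (1 + z)) := by positivity
    linarith)
  rw [(charWord_spec v hv).2.2, h3, e1, one_div_one_div, add_sub_cancel_left,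
    add_comm 1 z] at e2
  rw [add_comm 1 z] at hβ
  -- So far ζ is a fixed point of `rcf s ∘ rcf s`, one factor for `v` and one for `hat v`. If `rcf
  -- s` moved it, the strict contraction `rcf s` would preserve the distance of the two distinct
  -- points ζ and `rcf s` ζ.
  by_contra hne
  have := (abs_rcf_sub_le hs hβ.le hz.le).2 (charWord_ne_nil hv) hne
  rw [← e2, abs_sub_comm] at this
  exact lt_irrefl _ this

/-- Raising the last digit by 1 replaces the tail z by z + 1 = η. By `AltPair.rcf_eq`, η is thus the
fixed point of the even-length partner of the characteristic sequence. -/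
theorem rcf_η {v : List Letter} (hv : ∀ x ∈ v, x ∈ Aminus) (hne : v ≠ []) :
    0 < η v ∧ rcf (charWord v) (1 / (1 + η v) - 1) = η v := by
  have hs := charWord_pos hv
  have ho := charWord_not_even hv
  have key : ∀ u : List Letter, (∀ x ∈ u, x ∈ Aminus) → u ≠ [] →
      (∀ x ∈ wordShift 1 u, x ∈ Aminus) ∧ ∃ x ∈ wordShift 1 u, x ≠ two := by
    intro u hu hun
    induction u with
    | nil => exact absurd rfl hun
    | cons a u ih =>
      cases u with
      | nil =>
        obtain ⟨d, hd, rfl⟩ := hu a (by simp)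
        refine ⟨?_, Letter.fin (-1) (d + 1), by simp [wordShift, Letter.shift], ?_⟩
        · intro x hx
          simp only [wordShift, Letter.shift, List.mem_singleton] at hx
          exact ⟨d + 1, by omega, hx⟩
        · intro h
          simp only [two, Letter.fin.injEq] at h
          omega
      | cons b u =>
        obtain ⟨i1, x, hx, hx2⟩ := ih (fun x hx => hu x (List.mem_cons_of_mem _ hx)) (by simp)
        rw [wordShift]
        refine ⟨?_, x, List.mem_cons_of_mem _ hx, hx2⟩
        intro y hy
        rcases List.mem_cons.1 hy with rfl | hy
        · exact hu y (by simp)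
        · exact i1 y hy
  obtain ⟨k1, k2⟩ := key v hv hne
  obtain ⟨h1, h2, h3⟩ := cfStream_periodic k1 k2
  rw [η, if_neg hne]
  set z := cfStream (periodic (wordShift 1 v))
  rw [cfWord_wordShift 1 v hv hne] at h3
  have e := cfWord_wordOfChar_of_odd hs ho (x := z + 1) (by linarith)
  rw [(charWord_spec v hv).2.2] at e
  push_cast at h3
  rw [h3] at e
  exact ⟨by linarith, by rw [← e]; ring⟩

theorem rcf_lt_iff {s : List ℕ} (hs : Pos s) (hne : s ≠ []) {p x : ℝ} (hp : 0 ≤ p)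
    (hfix : rcf s p = p) (hx : 0 ≤ x) :
    (rcf s x < x ↔ p < x) ∧ (x < rcf s x ↔ x < p) := by
  rcases lt_trichotomy p x with h | rfl | h
  · have := sub_rcf_strict hs hne hp h
    exact ⟨⟨fun _ => h, fun _ => by linarith⟩, ⟨fun _ => by linarith, fun _ => by linarith⟩⟩
  · simp [hfix]
  · have := sub_rcf_strict hs hne hx h
    exact ⟨⟨fun _ => by linarith, fun _ => by linarith⟩, ⟨fun _ => h, fun _ => by linarith⟩⟩

theorem ζ_lt_iff {v : List Letter} (hv : ∀ x ∈ v, x ∈ Aminus) {x : ℝ} (hx : 0 ≤ x) :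
    ζ v < x ↔ rcf (charWord v) x < x :=
  (rcf_lt_iff (charWord_pos hv) (charWord_ne_nil hv) (rcf_ζ hv).1.le (rcf_ζ hv).2 hx).1.symm

theorem lt_η_iff {v : List Letter} (hv : ∀ x ∈ v, x ∈ Aminus) (hne : v ≠ []) {x : ℝ}
    (hx : 0 ≤ x) : x < η v ↔ x < rcf (charWord v) (1 / (1 + x) - 1) := by
  have hs := charWord_pos hv
  obtain ⟨s', h⟩ := exists_altPair hs (charWord_ne_nil hv) (charWord_ne_one hv hne)
  obtain ⟨h1, h2⟩ := rcf_η hv hne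
  rw [← h.symm.rcf_eq (by linarith)] at h2 ⊢
  exact (rcf_lt_iff (h.pos hs) h.ne_nil h1.le h2 hx).2.symm

theorem η_le_one {v : List Letter} (hv : ∀ x ∈ v, x ∈ Aminus) : η v ≤ 1 := by
  by_cases hne : v = []
  · simp [η, hne]
  have hs := charWord_pos hv
  obtain ⟨s', h⟩ := exists_altPair hs (charWord_ne_nil hv) (charWord_ne_one hv hne)
  obtain ⟨h1, h2⟩ := rcf_η hv hne
  rw [← h.symm.rcf_eq (by linarith)] at h2
  rw [← h2]
  exact rcf_le_one (h.pos hs) h.ne_nil h1.le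

/-- The rational number with tail 0 separates the end points. -/
theorem ζ_lt_η {v : List Letter} (hv : ∀ x ∈ v, x ∈ Aminus) : ζ v < η v := by
  have hs := charWord_pos hv
  have hr := rcf_pos hs (charWord_ne_nil hv) (y := 0) (by norm_num)
  set r := rcf (charWord v) 0
  have h1 : ζ v < r := by
    rw [ζ_lt_iff hv hr.le]
    exact rcf_lt_of_not_even hs (by norm_num) hr (charWord_not_even hv)
  by_cases hne : v = []
  · have : r = 1 := by simp [r, hne, charWord, rcf]
    rw [this] at h1
    simpa [η, hne] using h1
  · refine h1.trans ?_
    rw [lt_η_iff hv hne hr.le]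
    have h2 : 0 < 1 / (1 + r) := by positivity
    have h3 : 1 / (1 + r) < 1 := by
      rw [div_lt_one (by linarith)]
      linarith
    exact rcf_lt_of_not_even hs (by linarith) (by linarith) (charWord_not_even hv)

/-- This form covers the empty word too. There `s = [1]`, the lower bound is the fixed point g of
1/(1 + x), and the last inequality reads α < 1 + α, so only α ≤ 1 bounds from above. -/
theorem mem_Γv_iff {v : List Letter} (hv : ∀ x ∈ v, x ∈ Aminus) (α : ℝ) :
    α ∈ Γv v ↔ (0 < α ∧ α ≤ 1) ∧ rcf (charWord v) α < α ∧
      α < rcf (charWord v) (1 / (1 + α) - 1) := by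
  by_cases hne : v = []
  · subst hne
    have h5 : (2 : ℝ) < Real.sqrt 5 := by
      rw [Real.lt_sqrt] <;> norm_num
    have h5' : Real.sqrt 5 * Real.sqrt 5 = 5 := Real.mul_self_sqrt (by norm_num)
    have hg0 : 0 < g := by
      rw [g]
      linarith
    have hg : rcf [1] g = g := by
      simp only [rcf]
      apply inv_eq_of_mul_eq_one_right
      rw [g]
      push_cast
      nlinarith
    have hp : Pos [1] := by simp [Pos]
    simp only [Γv, if_true, charWord, mem_Ioc]
    constructor
    · rintro ⟨h1, h2⟩
      have h0 : 0 < α := hg0.trans h1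
      refine ⟨⟨h0, h2⟩, (rcf_lt_iff hp (by simp) hg0.le hg h0.le).1.2 h1, ?_⟩
      simp only [rcf]
      simp
    · rintro ⟨⟨h0, h2⟩, h3, -⟩
      exact ⟨(rcf_lt_iff hp (by simp) hg0.le hg h0.le).1.1 h3, h2⟩
  · rw [Γv, if_neg hne, mem_Ioo]
    constructor
    · rintro ⟨h1, h2⟩
      have h0 : 0 < α := (rcf_ζ hv).1.trans h1
      exact ⟨⟨h0, h2.le.trans (η_le_one hv)⟩, (ζ_lt_iff hv h0.le).1 h1,
        (lt_η_iff hv hne h0.le).1 h2⟩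
    · rintro ⟨⟨h0, -⟩, h1, h2⟩
      exact ⟨(ζ_lt_iff hv h0.le).2 h1, (lt_η_iff hv hne h0.le).2 h2⟩


/-! ### Orbits of the maps `T_α` -/

theorem T_div {α t : ℝ} {ε d : ℤ} (hε : ε = 1 ∨ ε = -1) (ht : t ∈ Ico (α - 1) α)
    (hd : 0 < (d : ℝ) + t) :
    T α ((ε : ℝ) / (d + t)) = t ∧ digit α ((ε : ℝ) / (d + t)) = Letter.fin ε d := by
  have hne : (ε : ℝ) / (d + t) ≠ 0 := by
    apply div_ne_zero _ hd.ne'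
    rcases hε with rfl | rfl <;> norm_num
  have habs : |1 / ((ε : ℝ) / (d + t))| = d + t := by
    rw [one_div_div, abs_div, abs_of_pos hd]
    rcases hε with rfl | rfl <;> norm_num
  have hfl : ⌊(d : ℝ) + t + 1 - α⌋ = d := by
    rw [Int.floor_eq_iff]
    constructor <;> linarith [ht.1, ht.2]
  rw [T, digit, if_neg hne, if_neg hne, habs, hfl]
  refine ⟨by ring, ?_⟩
  congr 1
  rcases hε with rfl | rfl
  · rw [if_pos (by push_cast; positivity)]
  · rw [if_neg]
    rw [not_le]
    push_cast
    exact div_neg_of_neg_of_pos (by norm_num) hd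

theorem expansion_succ (α x : ℝ) (n : ℕ) : expansion α x (n + 1) = expansion α (T α x) n := rfl

theorem pre_expansion_succ (α x : ℝ) (n : ℕ) :
    pre (expansion α x) (n + 1) = digit α x :: pre (expansion α (T α x)) n := by
  rw [pre_cons]
  rfl

/-- A word all of whose suffix values stay in the domain is followed by the orbit. -/
theorem orbit_cfWord {α x : ℝ} (hx : x ∈ Ico (α - 1) α) (h0 : 0 ≤ α) : ∀ (w : List Letter),
    (∀ a ∈ w, ∃ d, a = Letter.fin (-1) d) →
    (∀ i < w.length, α - 1 ≤ cfWord (w.drop i) x ∧ cfWord (w.drop i) x < 0) →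
    pre (expansion α (cfWord w x)) w.length = w ∧
      ∀ i ≤ w.length, (T α)^[i] (cfWord w x) = cfWord (w.drop i) x
  | [], _, _ => by simp [pre, cfWord]
  | a :: w, hl, hw => by
    obtain ⟨d, rfl⟩ := hl a (by simp)
    have hw' : ∀ i < w.length, α - 1 ≤ cfWord (w.drop i) x ∧ cfWord (w.drop i) x < 0 :=
      fun i hi => by simpa using hw (i + 1) (by simpa using hi)
    obtain ⟨i1, i2⟩ := orbit_cfWord hx h0 w (fun b hb => hl b (List.mem_cons_of_mem _ hb)) hw'
    have ht : cfWord w x ∈ Ico (α - 1) α := by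
      cases w with
      | nil => exact hx
      | cons b w =>
        have := hw' 0 (by simp)
        exact ⟨this.1, lt_of_lt_of_le this.2 h0⟩
    have hd : 0 < (d : ℝ) + cfWord w x := by
      have := (hw 0 (by simp)).2
      simp only [List.drop_zero, cfWord] at this
      by_contra h
      have h2 := div_nonneg_of_nonpos (a := ((-1 : ℤ) : ℝ)) (by norm_num) (not_lt.1 h)
      linarith
    obtain ⟨t1, t2⟩ := T_div (Or.inr rfl) ht hd
    have e : cfWord (Letter.fin (-1) d :: w) x = ((-1 : ℤ) : ℝ) / (d + cfWord w x) := rfl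
    rw [e]
    refine ⟨?_, ?_⟩
    · rw [List.length_cons, pre_expansion_succ, t1, t2, i1]
    · intro i hi
      cases i with
      | zero => rfl
      | succ i =>
        rw [Function.iterate_succ_apply, t1, List.drop_succ_cons]
        exact i2 i (by simpa using hi)

/-- The values of the suffixes of a word are controlled by those starting with a block. -/
theorem suffix_mem {α x : ℝ} (h0 : 0 ≤ α) (hx : -2 < x) : ∀ {t : List ℕ}, Pos t →
    (¬ Even t.length → -1 < x) →
    (∀ m < t.length, Even m → α - 1 ≤ cfWord (wordOfChar (t.drop m)) x) →
    ∀ i < (wordOfChar t).length, α - 1 ≤ cfWord ((wordOfChar t).drop i) x ∧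
      cfWord ((wordOfChar t).drop i) x < 0 := by
  -- Shortening a run of (-1:2) raises the value, so the lower bound passes from the start of the
  -- run to its interior. The value stays negative as long as a letter (-1:2) remains or what
  -- follows is negative.
  have rep : ∀ (k j : ℕ) (w : List Letter), j ≤ k → 0 < 1 + cfWord w x →
      (1 ≤ j ∨ 1 + cfWord w x < 1) →
      α - 1 ≤ cfWord (List.replicate k two ++ w) x →
      α - 1 ≤ cfWord (List.replicate j two ++ w) x ∧
        cfWord (List.replicate j two ++ w) x < 0 := by
    intro k j w hjk hw hj h
    have e1 := cfWord_replicate_two k w hw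
    have e2 := cfWord_replicate_two j w hw
    have hp : 0 < 1 / (1 + cfWord w x) := by positivity
    have hjk' : (j : ℝ) ≤ k := by exact_mod_cast hjk
    have hle : 1 / ((k : ℝ) + 1 / (1 + cfWord w x)) ≤ 1 / ((j : ℝ) + 1 / (1 + cfWord w x)) :=
      one_div_le_one_div_of_le (by positivity) (by linarith)
    have hlt : 1 / ((j : ℝ) + 1 / (1 + cfWord w x)) < 1 := by
      rw [div_lt_one (by positivity)]
      rcases hj with hj | hj
      · have : (1 : ℝ) ≤ j := by exact_mod_cast hj
        linarith
      · have : 1 < 1 / (1 + cfWord w x) := by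
          rw [lt_div_iff₀ hw]
          linarith
        have : (0 : ℝ) ≤ j := Nat.cast_nonneg j
        linarith
    constructor <;> linarith
  intro t
  induction t using List.twoStepInduction with
  | nil => simp [wordOfChar]
  | singleton a =>
    intro _ h1 hm i hi
    have h1' := h1 (by simp)
    have hm' := hm 0 (by simp) (by simp)
    simp only [wordOfChar, List.drop_zero, List.length_replicate, List.drop_replicate] at *
    have := rep (a - 1) (a - 1 - i) [] (by omega) (by simp only [cfWord]; linarith)
      (Or.inl (by omega)) (by simpa using hm')
    simpa using this
  | cons_cons a b t ih _ =>
    intro hs h1 hm i hi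
    have ih' := ih hs.tail.tail (fun h => h1 (by simpa [Nat.even_add_one] using h))
      (fun m hm1 hm2 => by
        have := hm (m + 2) (by simpa using hm1) (by simpa [Nat.even_add] using hm2)
        simpa using this)
    have hm0 := hm 0 (by simp) (by simp)
    have hb := hs.tail.head
    -- If nothing follows, `x` itself stands here and may lie below -1, as in the application with
    -- the tail u - 1; then `1 ≤ b` compensates.
    have hden : 1 < (2 : ℝ) + b + cfWord (wordOfChar t) x := by
      by_cases ht : wordOfChar t = []
      · rw [ht]
        simp only [cfWord]
        linarith
      · have := (ih' 0 (List.length_pos_iff.2 ht)).1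
        rw [List.drop_zero] at this
        linarith
    have hR : 0 < 1 + cfWord (Letter.fin (-1) (2 + b) :: wordOfChar t) x ∧
        1 + cfWord (Letter.fin (-1) (2 + b) :: wordOfChar t) x < 1 := by
      simp only [cfWord]
      push_cast
      rw [neg_div]
      have h2 : 1 / ((2 : ℝ) + b + cfWord (wordOfChar t) x) < 1 := by
        rw [div_lt_one (by linarith)]
        exact hden
      have h3 : 0 < 1 / ((2 : ℝ) + b + cfWord (wordOfChar t) x) :=
        one_div_pos.2 (by linarith)
      constructor <;> linarith
    simp only [wordOfChar, List.drop_zero] at hm0 hi ⊢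
    rw [List.drop_append, List.drop_replicate, List.length_replicate]
    rcases Nat.lt_or_ge (a - 1) i with h | h
    · obtain ⟨j, rfl⟩ := Nat.exists_eq_add_of_lt h
      have e1 : a - 1 - (a - 1 + j + 1) = 0 := by omega
      have e2 : a - 1 + j + 1 - (a - 1) = j + 1 := by omega
      rw [e1, e2, List.replicate_zero, List.nil_append, List.drop_succ_cons]
      apply ih'
      simp at hi
      omega
    · have e2 : i - (a - 1) = 0 := by omega
      rw [e2, List.drop_zero]
      exact rep (a - 1) (a - 1 - i) _ (by omega) hR.1 (Or.inr hR.2) hm0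

/-! ### Changing the last letter of a word -/

theorem length_wordShift (k : ℤ) : ∀ w : List Letter, (wordShift k w).length = w.length
  | [] => rfl
  | [_] => rfl
  | _ :: b :: w => by simp [wordShift, length_wordShift k (b :: w)]

theorem wordShift_cons (k : ℤ) (a : Letter) {w : List Letter} (hw : w ≠ []) :
    wordShift k (a :: w) = a :: wordShift k w := by
  cases w with
  | nil => exact absurd rfl hw
  | cons b w => rfl

theorem drop_wordShift (k : ℤ) (w : List Letter) (i : ℕ) :
    (wordShift k w).drop i = wordShift k (w.drop i) := by
  induction i generalizing w with
  | zero => rfl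
  | succ i ih =>
    match w with
    | [] => rfl
    | [a] => simp [wordShift]
    | a :: b :: w => rw [wordShift, List.drop_succ_cons, List.drop_succ_cons, ih]

theorem wordShift_mem (k : ℤ) (w : List Letter) (hw : ∀ a ∈ w, a ∈ Aminus) :
    ∀ a ∈ wordShift k w, ∃ d, a = Letter.fin (-1) d := by
  induction w with
  | nil => simp [wordShift]
  | cons a w ih =>
    obtain ⟨d, -, rfl⟩ := hw a (by simp)
    cases w with
    | nil => simp [wordShift, Letter.shift]
    | cons b w =>
      intro c hc
      rw [wordShift, List.mem_cons] at hc
      rcases hc with rfl | hc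
      · exact ⟨d, rfl⟩
      · exact ih (fun x hx => hw x (List.mem_cons_of_mem _ hx)) c hc

/-- The orbit of `v - 1` along a word. -/
theorem orbit_sub_one {α x : ℝ} (h0 : 0 ≤ α) (hx : x ∈ Ico (α - 1) α) (hx1 : -1 < x) {s : List ℕ}
    (hs : Pos s) {v : ℝ} (hv : 1 + cfWord (wordOfChar s) x = v)
    (h : ∀ m < s.length, Even m → α ≤ 1 + cfWord (wordOfChar (s.drop m)) x) :
    pre (expansion α (v - 1)) (wordOfChar s).length = wordOfChar s ∧
      (T α)^[(wordOfChar s).length] (v - 1) = x ∧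
      ∀ i < (wordOfChar s).length, (T α)^[i] (v - 1) < 0 := by
  have hm := suffix_mem h0 (x := x) (by linarith) hs (fun _ => hx1)
    (fun m hm he => by linarith [h m hm he])
  obtain ⟨h1, h2⟩ := orbit_cfWord hx h0 (wordOfChar s)
    (fun a ha => by
      obtain ⟨d, -, e⟩ := wordOfChar_mem s a ha
      exact ⟨d, e⟩) hm
  have e : v - 1 = cfWord (wordOfChar s) x := by linarith
  rw [e]
  refine ⟨h1, ?_, fun i hi => ?_⟩
  · rw [h2 _ le_rfl, List.drop_length, cfWord]
  · rw [h2 i hi.le]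
    exact (hm i hi).2

/-! ### Synchronization -/

/-- The tail `u` will be the point where the orbit of α arrives after the hat word; the lower bound
on `u` says that 1/(1 + u) - 1, where the orbit of α - 1 arrives, is below α. -/
theorem exists_rcf_eq {s : List ℕ} (hs : Pos s) {α : ℝ} (h0 : 0 < α) (h1 : rcf s α < α)
    (h2 : α < rcf s (1 / (1 + α) - 1)) :
    ∃ u ∈ Ioo (1 / (1 + α) - 1) α, rcf s u = α := by
  have h3 : 1 / (1 + α) < 1 := by
    rw [div_lt_one (by linarith)]
    linarith
  have h4 : 0 < 1 / (1 + α) := by positivity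
  have hc : ContinuousOn (rcf s) (Icc (1 / (1 + α) - 1) α) :=
    (continuousOn_rcf hs).mono fun y hy => by
      have := hy.1
      simp only [mem_Ioi]
      linarith
  obtain ⟨u, hu, he⟩ := intermediate_value_Ioo' (by linarith) hc ⟨h1, h2⟩
  exact ⟨u, hu, he⟩

/-- A negative tail is made positive by passing to the partner sequence. The suffix `[1]`, which has
no partner, has value 1/(1 + u) ≥ 1 ≥ α. -/
theorem le_rcf_drop {s : List ℕ} (hs : Pos s) (ha : Admissible s) {α u : ℝ} (h0 : 0 < α)
    (h1 : α ≤ 1) (hu : u ∈ Ioo (1 / (1 + α) - 1) α) (he : rcf s u = α) (m : ℕ)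
    (hm : m < s.length) : α ≤ rcf (s.drop m) u := by
  have h4 : 0 < 1 / (1 + α) := by positivity
  have hu1 : 0 < 1 + u := by linarith [hu.1]
  rcases le_or_gt 0 u with h | h
  · have := ha.le_rcf_drop hs h (by rw [he]; exact hu.2) m hm
    rwa [he] at this
  · by_cases hs1 : s = [1]
    · subst hs1
      have : m = 0 := by simpa using hm
      rw [this, List.drop_zero, he]
    · obtain ⟨s', hp⟩ := exists_altPair hs (List.ne_nil_of_length_pos (by omega)) hs1
      rcases hp.symm.drop m hm with ⟨h5, h6⟩ | h5
      · have hz0 : 0 ≤ 1 / (1 + u) - 1 := by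
          rw [sub_nonneg, le_div_iff₀ hu1]
          linarith
        have hz1 : 1 / (1 + u) - 1 < α := by
          have : 1 / (1 + u) < 1 + α := by
            rw [div_lt_iff₀ hu1]
            have := hu.1
            rw [lt_iff_lt_of_le_iff_le (Iff.rfl), sub_lt_iff_lt_add,
              div_lt_iff₀ (by linarith)] at this
            linarith
          linarith
        have e := hp.rcf_eq (z := u) (by linarith)
        rw [he] at e
        have := (hp.admissible hs ha).le_rcf_drop (hp.pos hs) hz0 (by rw [← e]; exact hz1) m h6
        rwa [← e, ← h5.symm.rcf_eq (by linarith)] at this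
      · rw [h5]
        simp only [rcf]
        apply h1.trans
        apply (one_le_inv₀ _).2 <;> push_cast <;> linarith

/-- The conclusion means α ≤ g. It is what keeps both final points u and 1/(1 + u) - 1 at or above α
- 1. -/
theorem mul_one_add_le_one {s : List ℕ} (hs : Pos s) (ho : ¬ Even s.length) (hs1 : s ≠ [1])
    {α u : ℝ} (h0 : 0 < α) (hu : u ∈ Ioo (1 / (1 + α) - 1) α) (he : rcf s u = α)
    (h : ∀ m < s.length, α ≤ rcf (s.drop m) u) : α * (1 + α) ≤ 1 := by
  match s, ho with
  | [], ho => simp at ho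
  | [a], _ =>
    have ha : 1 ≤ a := hs a (by simp)
    have ha' : a ≠ 1 := by
      rintro rfl
      exact hs1 rfl
    have ha2 : (2 : ℝ) ≤ a := by exact_mod_cast (by omega : 2 ≤ a)
    simp only [rcf] at he
    have hu1 := hu.1
    have h4 : 0 < 1 / (1 + α) := by positivity
    have e : α * (a + u) = 1 := by
      rw [← he]
      apply inv_mul_cancel₀
      linarith
    have h5 : α * (1 + 1 / (1 + α)) ≤ 1 := by nlinarith
    have h6 : α * (1 + 1 / (1 + α)) * (1 + α) ≤ 1 * (1 + α) :=
      mul_le_mul_of_nonneg_right h5 (by linarith)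
    have h7 : α * (1 + 1 / (1 + α)) * (1 + α) = α * (1 + α) + α := by
      field_simp
    linarith
  | a :: b :: t, _ =>
    have h1 := h 1 (by simp)
    simp only [List.drop_succ_cons, List.drop_zero] at h1
    have ha := hs.head
    rw [rcf] at he
    have e : α * (a + rcf (b :: t) u) = 1 := by
      conv_lhs => rw [← he]
      apply inv_mul_cancel₀
      linarith
    nlinarith

/-- If `(1 + x)(1 + y) = 1`, then the digits of `x` and `y` are related by `(W)`, and the orbits
of `x` and `y` merge. -/
theorem merge {α x y : ℝ} (hx : -1 < x) (h : (1 + x) * (1 + y) = 1) :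
    digit α y = (digit α x).W ∧ T α x = T α y := by
  have key : ∀ x y : ℝ, -1 < x → x < 0 → (1 + x) * (1 + y) = 1 → 0 < y ∧
      |1 / y| = |1 / x| - 1 := by
    intro x y h1 h2 h
    have hy : 0 < y := by nlinarith
    refine ⟨hy, ?_⟩
    rw [abs_of_pos (by positivity), abs_of_neg (one_div_neg.2 h2)]
    have e : y = -x / (1 + x) := by
      rw [eq_div_iff (by linarith)]
      linarith
    rw [e]
    have h3 : 1 + x ≠ 0 := by linarith
    have h4 : x ≠ 0 := h2.ne
    field_simp
    ring
  rcases lt_trichotomy x 0 with h1 | rfl | h1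
  · obtain ⟨hy, e⟩ := key x y hx h1 h
    have e2 : |1 / x| - 1 + 1 - α = |1 / x| + 1 - α - 1 := by ring
    rw [digit, digit, T, T, if_neg hy.ne', if_neg h1.ne, if_neg h1.ne, if_neg hy.ne',
      if_pos hy.le, if_neg (not_le.2 h1), e, e2, Int.floor_sub_one]
    refine ⟨?_, by push_cast; ring⟩
    simp [Letter.W]
    ring
  · have : y = 0 := by linarith
    subst this
    simp [digit, Letter.W]
  · have hy1 : -1 < y := by
      by_contra hc
      have : (1 + x) * (1 + y) ≤ 0 := mul_nonpos_of_nonneg_of_nonpos (by linarith) (by linarith)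
      linarith
    have hy0 : y < 0 := by nlinarith
    obtain ⟨-, e⟩ := key y x hy1 hy0 (by linarith)
    have e2 : |1 / y| + 1 - α = |1 / x| + 1 - α + 1 := by linarith
    rw [digit, digit, T, T, if_neg hy0.ne, if_neg h1.ne', if_neg h1.ne', if_neg hy0.ne,
      if_pos h1.le, if_neg (not_le.2 hy0), e2, Int.floor_add_one]
    refine ⟨by simp [Letter.W], ?_⟩
    push_cast
    linarith

theorem synchronization {v : List Letter} (hv : v ∈ F) {α : ℝ} (hα : α ∈ Γv v) :
    ∃ x y : ℝ, -1 < x ∧ (1 + x) * (1 + y) = 1 ∧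
      pre (expansion α (α - 1)) v.length = v ∧
      pre (expansion α α) (hat v).length = wordW (wordShift (-1) (hat v)) ∧
      (T α)^[v.length] (α - 1) = x ∧ (T α)^[(hat v).length] α = y := by
  have hA := hv.1
  have hs := charWord_pos hA
  have ho := charWord_not_even hA
  have hne := charWord_ne_nil hA
  obtain ⟨⟨h0, h1⟩, h2, h3⟩ := (mem_Γv_iff hA α).1 hα
  obtain ⟨u, hu, he⟩ := exists_rcf_eq hs h0 h2 h3
  have hlow := le_rcf_drop hs (F.admissible hv) h0 h1 hu he
  have h4 : 0 < 1 / (1 + α) := by positivity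
  have hu1 : 0 < 1 + u := by linarith [hu.1]
  have hx1 : 1 / (1 + u) < 1 + α := by
    rw [div_lt_iff₀ hu1]
    have := hu.1
    rw [sub_lt_iff_lt_add, div_lt_iff₀ (by linarith)] at this
    linarith
  -- For `[1]` the number α may exceed g, but there α = 1/(1 + u) holds exactly.
  have hdom : α - 1 ≤ u ∧ α ≤ 1 / (1 + u) := by
    by_cases hs1 : charWord v = [1]
    · rw [hs1] at he
      simp only [rcf, Nat.cast_one] at he
      rw [one_div, he]
      refine ⟨?_, le_rfl⟩
      by_contra hc
      have : 1 ≤ (1 + u)⁻¹ := (one_le_inv₀ hu1).2 (by linarith)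
      have h6 : u < 0 := by linarith
      have : 1 < (1 + u)⁻¹ := (one_lt_inv₀ hu1).2 (by linarith)
      linarith
    · have := mul_one_add_le_one hs ho hs1 h0 hu he hlow
      constructor
      · have : α ≤ 1 / (1 + α) := by
          rw [le_div_iff₀ (by linarith)]
          exact this
        linarith [hu.1]
      · rw [le_div_iff₀ hu1]
        nlinarith [hu.2]
  set x := 1 / (1 + u) - 1 with hxdef
  have hx : x ∈ Ico (α - 1) α := ⟨by linarith [hdom.2], by linarith⟩
  have hx1' : 1 / (1 + x) - 1 = u := by
    rw [hxdef]
    field_simp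
    ring
  have hodd : ∀ m, Even m → m < (charWord v).length →
      1 + cfWord (wordOfChar ((charWord v).drop m)) x = rcf ((charWord v).drop m) u := by
    intro m hm hm'
    rw [← hx1']
    apply cfWord_wordOfChar_of_odd (hs.drop m) _ (by linarith [hx.1])
    rw [List.length_drop, Nat.even_sub hm'.le]
    tauto
  have hv' := (charWord_spec v hA).2.2
  have o1 := orbit_sub_one (v := α) h0.le hx (by linarith [hx.1]) hs
    ((hodd 0 (by simp) (List.length_pos_iff.2 hne)).trans he)
    (fun m hm hm' => by rw [hodd m hm' hm]; exact hlow m hm)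
  rw [hv'] at o1
  obtain ⟨p1, p2⟩ : pre (expansion α α) (hat v).length = wordW (wordShift (-1) (hat v)) ∧
      (T α)^[(hat v).length] α = u := by
    obtain ⟨a, t, hat', ht, hh⟩ := hat_eq hA
    rw [hat'] at hs he hlow
    have hval : ∀ m, Even m → m ≤ t.length →
        1 + cfWord (wordOfChar (t.drop m)) (u - 1) = rcf (t.drop m) u := by
      intro m hm hm'
      have := cfWord_wordOfChar_of_even (hs.tail.drop m) (x := u - 1)
        (by rw [List.length_drop, Nat.even_sub hm']; tauto) (by linarith)
      rwa [add_sub_cancel] at this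
    have hmem := suffix_mem h0.le (x := u - 1) (by linarith) hs.tail (fun h => absurd ht h)
      (fun m hm he' => by
        have := hlow (m + 1) (by simpa using hm)
        rw [List.drop_succ_cons, ← hval m he' hm.le] at this
        linarith)
    -- Lowering the last digit by 1 turns the tail `u` into `u - 1`, for which the even-length
    -- formula gives `rcf` with tail `u`.
    have hcf : ∀ i < (wordOfChar t).length,
        cfWord ((wordShift (-1) (wordOfChar t)).drop i) u =
          cfWord ((wordOfChar t).drop i) (u - 1) := by
      intro i hi
      rw [drop_wordShift, cfWord_wordShift]
      · push_cast
        rfl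
      · exact fun x hx => wordOfChar_mem t x (List.mem_of_mem_drop hx)
      · apply List.ne_nil_of_length_pos
        simpa using hi
    obtain ⟨o2, o3⟩ := orbit_cfWord (x := u) ⟨hdom.1, hu.2⟩ h0.le (wordShift (-1) (wordOfChar t))
      (wordShift_mem _ _ (wordOfChar_mem t)) (fun i hi => by
        rw [length_wordShift] at hi
        rw [hcf i hi]
        exact hmem i hi)
    have o3' := o3 _ le_rfl
    rw [List.drop_length, cfWord] at o3'
    rw [length_wordShift] at o2 o3'
    -- The first digit 2 + a becomes 1 + a under (W). If the hat word has one letter only, the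
    -- change of the last letter hits the same digit and leaves a.
    obtain ⟨d, hd1, hd2⟩ : ∃ d : ℤ,
        wordW (wordShift (-1) (hat v)) = Letter.fin 1 d :: wordShift (-1) (wordOfChar t) ∧
        α = ((1 : ℤ) : ℝ) / (d + cfWord (wordShift (-1) (wordOfChar t)) u) := by
      rw [rcf] at he
      by_cases hw : wordOfChar t = []
      · refine ⟨a, ?_, ?_⟩
        · rw [hh, hw]
          simp [wordShift, Letter.shift, wordW, Letter.W]
          ring
        · have := hval 0 (by simp) (by simp)
          rw [List.drop_zero, hw] at this
          simp only [cfWord] at this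
          rw [← he, hw, ← this]
          simp [wordShift, cfWord]
      · refine ⟨1 + a, ?_, ?_⟩
        · rw [hh, wordShift_cons _ _ hw]
          simp [wordW, Letter.W]
          ring
        · have e1 := hval 0 (by simp) (by simp)
          have e2 := hcf 0 (List.length_pos_iff.2 hw)
          simp only [List.drop_zero] at e1 e2
          rw [← he, ← e1, e2]
          push_cast
          rw [one_div]
          congr 1
          ring
    have hX : cfWord (wordShift (-1) (wordOfChar t)) u ∈ Ico (α - 1) α := by
      by_cases hw : wordOfChar t = []
      · rw [hw]
        exact ⟨hdom.1, hu.2⟩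
      · have e2 := hcf 0 (List.length_pos_iff.2 hw)
        have e3 := hmem 0 (List.length_pos_iff.2 hw)
        simp only [List.drop_zero] at e2 e3
        rw [e2]
        exact ⟨e3.1, by linarith [e3.2]⟩
    have hpos : 0 < (d : ℝ) + cfWord (wordShift (-1) (wordOfChar t)) u := by
      by_contra hc
      have := div_nonpos_of_nonneg_of_nonpos (a := ((1 : ℤ) : ℝ)) (by norm_num) (not_lt.1 hc)
      rw [← hd2] at this
      linarith
    obtain ⟨t1, t2⟩ := T_div (Or.inl rfl) hX hpos
    rw [← hd2] at t1 t2
    constructor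
    · rw [hd1, hh, List.length_cons, pre_expansion_succ, t1, t2, o2]
    · rw [hh, List.length_cons, Function.iterate_succ_apply, t1, o3']
  refine ⟨x, u, by linarith [hx.1], ?_, o1.1, p1, o1.2.1, p2⟩
  rw [hxdef]
  field_simp
  ring

/-- Since (1 + x)(1 + y) = 1, the points x and y are not both negative. The times are at least 1:
the hat word is never empty, and for empty v the point x is α - 1 ≤ 0, so that y ≥ 0. -/
theorem Γv_subset {v : List Letter} (hv : v ∈ F) : Γv v ⊆ Γ := by
  intro α hα
  obtain ⟨⟨h0, h1⟩, -⟩ := (mem_Γv_iff hv.1 α).1 hα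
  obtain ⟨x, y, hx, hxy, -, -, o1, o2⟩ := synchronization hv hα
  refine ⟨⟨h0, h1⟩, ?_⟩
  rcases le_or_gt 0 y with hy | hy
  · obtain ⟨a, t, -, -, hh⟩ := hat_eq hv.1
    exact ⟨(hat v).length, by simp [hh], Or.inr (by rw [o2]; exact hy)⟩
  · have hx0 : 0 < x := by nlinarith
    refine ⟨v.length, ?_, Or.inl (by rw [o1]; exact hx0.le)⟩
    by_contra hc
    have : v.length = 0 := by omega
    rw [this, Function.iterate_zero, id] at o1
    linarith


/-! ### The intervals and the first return below `α` -/

/-- The numbers that are minimal in their orbit under the Gauss map. -/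
def gaussMinimal : Set ℝ := {α | α ∈ Ioc (0 : ℝ) 1 ∧ ∀ n, α ≤ gauss^[n] α}

theorem drop_pre_dig (x : ℝ) (m n : ℕ) :
    (pre (dig x) n).drop m = pre (dig (gauss^[m] x)) (n - m) := by
  rw [drop_pre]
  congr 1
  funext i
  rw [dig_iterate]

theorem iterate_gauss_eq_rcf {x : ℝ} (hx : x ∈ Icc (0 : ℝ) 1) {m n : ℕ} (h : m ≤ n) :
    gauss^[m] x = rcf ((pre (dig x) n).drop m) (gauss^[n] x) := by
  rw [drop_pre_dig]
  have := eq_rcf_pre (iterate_gauss_mem hx m).1 (n - m)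
  rwa [← Function.iterate_add_apply, Nat.sub_add_cancel h] at this

theorem pos_pre {a : ℕ → ℕ} {n : ℕ} (h : ∀ i < n, 1 ≤ a i) : Pos (pre a n) := by
  intro b hb
  simp only [pre, List.mem_map, List.mem_range] at hb
  obtain ⟨i, hi, rfl⟩ := hb
  exact h i hi

theorem one_le_dig_of_pos {x : ℝ} (hx : x ∈ Icc (0 : ℝ) 1) {i : ℕ} (h : 0 < gauss^[i] x) :
    1 ≤ dig x i :=
  one_le_dig h (iterate_gauss_mem hx i).2

theorem admissible_pre_dig {α : ℝ} (h0 : 0 < α) (h1 : α ≤ 1) {N : ℕ}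
    (hN : ∀ i < N, α ≤ gauss^[i] α) (hy : gauss^[N] α < α) : Admissible (pre (dig α) N) := by
  have hα : α ∈ Icc (0 : ℝ) 1 := ⟨h0.le, h1⟩
  have hs : Pos (pre (dig α) N) :=
    pos_pre fun i hi => one_le_dig_of_pos hα (h0.trans_le (hN i hi))
  intro m hm1 hm
  rw [length_pre] at hm ⊢
  have hd := drop_pre_dig α m N
  have ht := take_pre (dig α) (N - m) N (by omega)
  have hp1 : Pos (pre (dig (gauss^[m] α)) (N - m)) := hd ▸ hs.drop m
  have hp2 : Pos (pre (dig α) (N - m)) := ht ▸ hs.take _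
  rw [hd, ht]
  constructor
  · rcases altLT_trichotomy _ _ (by rw [length_pre, length_pre] :
      (pre (dig (gauss^[m] α)) (N - m)).length = (pre (dig α) (N - m)).length) with h | h | h
    · exact Or.inl h
    · exact Or.inr h
    · exact absurd (lt_of_altLT_dig h0.le (iterate_gauss_mem hα m).1 hp2 hp1 h)
        (not_lt.2 (hN m hm))
  -- If the suffix equals a prefix of even length, an increasing map sends G^N(α) to G^m(α) and
  -- G^(N-m)(α) to α. As G^N(α) < α ≤ G^(N-m)(α), this would give G^m(α) < α.
  · intro he heq
    have e1 := iterate_gauss_eq_rcf hα (m := m) (n := N) (by omega)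
    have e2 := eq_rcf_pre h0.le (N - m)
    rw [hd, heq] at e1
    have h2 := hN m hm
    rw [e1] at h2
    have h3 : gauss^[N] α < gauss^[N - m] α := hy.trans_le (hN _ (by omega))
    have h4 := rcf_lt_of_even hp2 (by linarith [(iterate_gauss_mem hα N).1]) h3
      (by rwa [length_pre])
    rw [← e2] at h4
    exact not_lt.2 h2 h4

/-- If the first return time N is odd, the partial quotients up to N give the label directly, with
tail y = G^N(α) in [0, α). If N is even, the odd-length partner does, with tail 1/(1 + y) - 1 in
(1/(1 + α) - 1, 0]. -/
theorem exists_mem_Γv {α : ℝ} (h0 : 0 < α) (h1 : α ≤ 1) (h : α ∉ gaussMinimal) :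
    ∃ v ∈ F, α ∈ Γv v := by
  classical
  have hα : α ∈ Icc (0 : ℝ) 1 := ⟨h0.le, h1⟩
  have hex : ∃ n, gauss^[n] α < α := by
    by_contra hc
    push Not at hc
    exact h ⟨⟨h0, h1⟩, hc⟩
  obtain ⟨N, hy, hN⟩ : ∃ N, gauss^[N] α < α ∧ ∀ i < N, α ≤ gauss^[i] α :=
    ⟨Nat.find hex, Nat.find_spec hex, fun i hi => not_lt.1 (Nat.find_min hex hi)⟩
  have hN0 : N ≠ 0 := by
    rintro rfl
    exact lt_irrefl _ hy
  have hA := admissible_pre_dig h0 h1 hN hy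
  have hs : Pos (pre (dig α) N) :=
    pos_pre fun i hi => one_le_dig_of_pos hα (h0.trans_le (hN i hi))
  have he := eq_rcf_pre h0.le N
  have hlen := length_pre (dig α) N
  have hy0 := (iterate_gauss_mem hα N).1
  set y := gauss^[N] α
  set D := pre (dig α) N
  have hz : 0 < 1 / (1 + α) := by positivity
  have hz1 : 1 / (1 + α) < 1 := by
    rw [div_lt_one (by linarith)]
    linarith
  have fin : ∀ s, Pos s → ¬ Even s.length → Admissible s → rcf s α < α →
      α < rcf s (1 / (1 + α) - 1) → ∃ v ∈ F, α ∈ Γv v := by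
    intro s p1 p2 p3 p4 p5
    have p2' := Nat.not_even_iff_odd.1 p2
    refine ⟨wordOfChar s, wordOfChar_mem_F p1 p2' p3, ?_⟩
    rw [mem_Γv_iff (wordOfChar_mem s), charWord_unique s p2' p1]
    exact ⟨⟨h0, h1⟩, p4, p5⟩
  by_cases hev : Even N
  · obtain ⟨s, hp⟩ := exists_altPair hs (List.ne_nil_of_length_pos (by omega)) (by
      intro hc
      rw [hc] at hlen
      rw [← hlen] at hev
      simp at hev)
    have hsp := hp.pos hs
    have hso : ¬ Even s.length := by
      rw [hp.even_iff, hlen]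
      exact not_not.2 hev
    have e := hp.rcf_eq (z := y) (by linarith)
    rw [← he] at e
    have h2 : 0 < 1 / (1 + y) := by positivity
    have h3 : 1 / (1 + y) ≤ 1 := by
      rw [div_le_one (by linarith)]
      linarith
    have h4 : 1 / (1 + α) < 1 / (1 + y) :=
      one_div_lt_one_div_of_lt (by linarith) (by linarith)
    refine fin s hsp hso (hp.admissible hs hA) ?_ ?_
    · conv_rhs => rw [e]
      exact rcf_lt_of_not_even hsp (by linarith) (by linarith) hso
    · conv_lhs => rw [e]
      exact rcf_lt_of_not_even hsp (by linarith) (by linarith) hso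
  · have hso : ¬ Even D.length := by rwa [hlen]
    refine fin D hs hso hA ?_ ?_
    · conv_rhs => rw [he]
      exact rcf_lt_of_not_even hs (by linarith) hy hso
    · conv_lhs => rw [he]
      exact rcf_lt_of_not_even hs (by linarith) (by linarith) hso

theorem rcf_lt_one {s : List ℕ} (hs : Pos s) (hne : s ≠ []) {y : ℝ} (hy : 0 < y) :
    rcf s y < 1 := by
  cases s with
  | nil => exact absurd rfl hne
  | cons a s =>
    have h1 : 0 < rcf s y := by
      cases s with
      | nil => exact hy
      | cons b s => exact rcf_pos hs.tail (by simp) (by linarith)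
    have := hs.head
    simp only [rcf]
    apply inv_lt_one_of_one_lt₀
    linarith

/-- The first return below `α` and the digits up to it are determined by the label. -/
theorem first_return {v : List Letter} (hv : v ∈ F) {α : ℝ} (hα : α ∈ Γv v) :
    ∃ D, (D = charWord v ∨ AltPair (charWord v) D) ∧ pre (dig α) D.length = D ∧
      gauss^[D.length] α < α ∧ ∀ i < D.length, α ≤ gauss^[i] α := by
  have hs := charWord_pos hv.1
  have hne := charWord_ne_nil hv.1
  have hA := F.admissible hv
  obtain ⟨⟨h0, h1⟩, h2, h3⟩ := (mem_Γv_iff hv.1 α).1 hα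
  obtain ⟨u, hu, he⟩ := exists_rcf_eq hs h0 h2 h3
  have h4 : 0 < 1 / (1 + α) := by positivity
  have hu1 : 0 < 1 + u := by linarith [hu.1]
  have fin : ∀ D, (D = charWord v ∨ AltPair (charWord v) D) → ∀ y, 0 ≤ y → y < α →
      rcf D y = α → (∀ m, 1 ≤ m → m < D.length → rcf (D.drop m) y < 1) →
      ∃ D, (D = charWord v ∨ AltPair (charWord v) D) ∧ pre (dig α) D.length = D ∧
        gauss^[D.length] α < α ∧ ∀ i < D.length, α ≤ gauss^[i] α := by
    intro D hD y hy0 hyα e hlt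
    have hDp : Pos D := by
      rcases hD with rfl | hD
      · exact hs
      · exact hD.pos hs
    have hDA : Admissible D := by
      rcases hD with rfl | hD
      · exact hA
      · exact hD.admissible hs hA
    obtain ⟨o1, o2⟩ := rcf_orbit (s := D) (y := y) (fun m hm hm' => by
      refine ⟨rcf_nonneg (hDp.drop m) hy0, ?_⟩
      rcases hm'.eq_or_lt with rfl | hm'
      · rw [List.drop_length]
        simp only [rcf]
        linarith
      · exact hlt m hm hm')
    rw [e] at o1 o2
    refine ⟨D, hD, o1, ?_, ?_⟩
    · rw [o2 _ le_rfl, List.drop_length]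
      exact hyα
    · intro i hi
      rw [o2 i hi.le]
      have := hDA.le_rcf_drop hDp hy0 (by rw [e]; exact hyα) i hi
      rwa [e] at this
  have pos_case : ∀ D, Pos D → ∀ y, 0 < y → ∀ m, 1 ≤ m → m < D.length →
      rcf (D.drop m) y < 1 := by
    intro D hD y hy m _ hm
    exact rcf_lt_one (hD.drop m) (List.ne_nil_of_length_pos (by simpa using hm)) hy
  by_cases hs1 : charWord v = [1]
  · have hu0 : 0 ≤ u := by
      rw [hs1] at he
      simp only [rcf, Nat.cast_one] at he
      by_contra hc
      have : 1 < (1 + u)⁻¹ := (one_lt_inv₀ hu1).2 (by linarith)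
      linarith
    refine fin _ (Or.inl rfl) u hu0 hu.2 he (fun m hm hm' => ?_)
    rw [hs1] at hm'
    simp at hm'
    omega
  obtain ⟨s', hp⟩ := exists_altPair hs hne hs1
  -- The Gauss map only sees nonnegative remainders, so the sign of `u` decides which member of the
  -- pair consists of the actual partial quotients.
  rcases lt_trichotomy u 0 with hu0 | hu0 | hu0
  · have e := hp.rcf_eq (z := u) (by linarith)
    have hz : 0 < 1 / (1 + u) - 1 := by
      rw [sub_pos, lt_div_iff₀ hu1]
      linarith
    refine fin s' (Or.inr hp) (1 / (1 + u) - 1) hz.le ?_ (by rw [← e, he])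
      (pos_case s' (hp.pos hs) _ hz)
    have : 1 / (1 + u) < 1 + α := by
      rw [div_lt_iff₀ hu1]
      have := hu.1
      rw [sub_lt_iff_lt_add, div_lt_iff₀ (by linarith)] at this
      linarith
    linarith
  · subst hu0
    have e := hp.rcf_eq (z := 0) (by norm_num)
    norm_num at e
    -- At tail 0 the Gauss map produces the expansion whose last term is at least 2; the other one
    -- passes through the forbidden remainder 1.
    have zero_case : ∀ D D', AltPair D D' → Pos D → ∀ t a, 1 ≤ a → D = t ++ [a + 1] →
        ∀ m, 1 ≤ m → m < D.length → rcf (D.drop m) 0 < 1 := by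
      rintro D D' hDD hD t a ha rfl m - hm
      have hmt : m ≤ t.length := by
        simp at hm
        omega
      have := hD.drop m
      rw [List.drop_append_of_le_length hmt] at this ⊢
      exact AltPair.rcf_zero_lt_one ⟨t.drop m, a, ha, Or.inl ⟨rfl, rfl⟩⟩ this
    have hp' := hp
    obtain ⟨t, a, ha, ⟨ht, -⟩ | ⟨-, ht⟩⟩ := hp'
    · exact fin _ (Or.inl rfl) 0 le_rfl h0 he (zero_case _ _ hp hs t a ha ht)
    · exact fin s' (Or.inr hp) 0 le_rfl h0 (e.symm.trans he)
        (zero_case _ _ hp.symm (hp.pos hs) t a ha ht)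
  · exact fin _ (Or.inl rfl) u hu0.le hu.2 he (pos_case _ hs u hu0)

/-- The first return time and the partial quotients up to it are functions of α. The label's
sequence is the odd-length member of the resulting pair. -/
theorem pairwiseDisjoint_Γv : F.PairwiseDisjoint Γv := by
  intro v hv w hw hvw
  refine Set.disjoint_left.2 fun α h1 h2 => hvw ?_
  obtain ⟨D, a1, a2, a3, a4⟩ := first_return hv h1
  obtain ⟨D', b1, b2, b3, b4⟩ := first_return hw h2
  have hl : D.length = D'.length := by
    rcases lt_trichotomy D.length D'.length with h | h | h
    · exact absurd a3 (not_lt.2 (b4 _ h))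
    · exact h
    · exact absurd b3 (not_lt.2 (a4 _ h))
  have hD : D = D' := by rw [← a2, ← b2, hl]
  subst hD
  have hc : charWord v = charWord w := by
    have o1 := charWord_not_even hv.1
    have o2 := charWord_not_even hw.1
    rcases a1 with rfl | a1 <;> rcases b1 with b1 | b1
    · exact b1
    · exact absurd (b1.even_iff.2 o2) o1
    · exact absurd (a1.even_iff.2 o1) (b1 ▸ o2)
    · exact a1.symm.eq_of b1.symm
  rw [← (charWord_spec v hv.1).2.2, ← (charWord_spec w hw.1).2.2, hc]


/-! ### Infinite words with a given characteristic sequence -/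

theorem wordOfChar_append : ∀ (s t : List ℕ), Even s.length →
    wordOfChar (s ++ t) = wordOfChar s ++ wordOfChar t
  | [], _, _ => rfl
  | [a], _, h => by simp at h
  | a :: b :: s, t, h => by
    have h' : Even s.length := by simpa [Nat.even_add_one] using h
    simp [wordOfChar, wordOfChar_append s t h']

/-- The first `2k` terms of `a` describe a prefix of `w`, for all `k`. -/
def HasChar (w : ℕ → Letter) (a : ℕ → ℕ) : Prop :=
  ∀ k, pre w (wordOfChar (pre a (2 * k))).length = wordOfChar (pre a (2 * k))

theorem wordOfChar_pre_succ (a : ℕ → ℕ) (k : ℕ) : wordOfChar (pre a (2 * (k + 1))) =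
    List.replicate (a 0 - 1) two ++
      Letter.fin (-1) (2 + a 1) :: wordOfChar (pre (fun i => a (i + 2)) (2 * k)) := by
  rw [show 2 * (k + 1) = 2 * k + 1 + 1 by ring, pre_cons, pre_cons]
  rfl

theorem le_length_wordOfChar (a : ℕ → ℕ) (k : ℕ) : k ≤ (wordOfChar (pre a (2 * k))).length := by
  induction k generalizing a with
  | zero => simp
  | succ k ih =>
    rw [wordOfChar_pre_succ]
    have := ih (fun i => a (i + 2))
    simp
    omega

theorem HasChar.first_block {w : ℕ → Letter} {a : ℕ → ℕ} (h : HasChar w a) :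
    (∀ i < a 0 - 1, w i = two) ∧ w (a 0 - 1) = Letter.fin (-1) (2 + a 1) ∧
      HasChar (fun i => w (a 0 - 1 + 1 + i)) (fun i => a (i + 2)) := by
  have key : ∀ k, pre w (a 0 - 1) = List.replicate (a 0 - 1) two ∧
      w (a 0 - 1) = Letter.fin (-1) (2 + a 1) ∧
      pre (fun i => w (a 0 - 1 + 1 + i))
        (wordOfChar (pre (fun i => a (i + 2)) (2 * k))).length =
          wordOfChar (pre (fun i => a (i + 2)) (2 * k)) := by
    intro k
    have := h (k + 1)
    rw [wordOfChar_pre_succ, List.length_append, List.length_cons, List.length_replicate,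
      Nat.add_comm _ 1, ← Nat.add_assoc, pre_add, pre_succ, List.append_assoc] at this
    obtain ⟨h1, h2⟩ := List.append_inj this (by simp [length_pre])
    simp only [List.singleton_append, List.cons.injEq] at h2
    exact ⟨h1, h2.1, h2.2⟩
  refine ⟨fun i hi => ?_, (key 0).2.1, fun k => (key k).2.2⟩
  have : w i ∈ pre w (a 0 - 1) := by
    simp only [pre, List.mem_map, List.mem_range]
    exact ⟨i, hi, rfl⟩
  rw [(key 0).1] at this
  exact List.eq_of_mem_replicate this

theorem fin_ne_two {b : ℕ} (hb : 1 ≤ b) : Letter.fin (-1) (2 + (b : ℤ)) ≠ two := by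
  intro h
  simp only [two, Letter.fin.injEq] at h
  omega

theorem HasChar.charStream_eq {w : ℕ → Letter} {a : ℕ → ℕ} (h : HasChar w a)
    (ha : ∀ i, 1 ≤ a i) (i : ℕ) : charStream w i = a i := by
  classical
  induction i using Nat.strong_induction_on generalizing w a with
  | _ i ih =>
    obtain ⟨h1, h2, h3⟩ := h.first_block
    have hne : w (a 0 - 1) ≠ two := by
      rw [h2]
      exact fin_ne_two (ha 1)
    have hex : ∃ i, w i ≠ two := ⟨_, hne⟩
    have hf : Nat.find hex = a 0 - 1 :=
      (Nat.find_eq_iff hex).2 ⟨hne, fun n hn => not_not.2 (h1 n hn)⟩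
    match i with
    | 0 =>
      have := ha 0
      have e : charStream w 0 = ((Nat.find hex + 1 : ℕ) : ℕ∞) := by
        simp [charStream, lead, hex]
      rw [e, hf, Nat.sub_add_cancel this]
    | 1 =>
      have e : charStream w 1 = (((w (Nat.find hex)).excess : ℕ) : ℕ∞) := by
        simp [charStream, leadExcess, hex]
      rw [e, hf, h2]
      simp [Letter.excess]
    | i + 2 =>
      have e : afterLead w = fun n => w (a 0 - 1 + 1 + n) := by
        simp [afterLead, hex, hf]
      rw [charStream_add_two, e]
      exact ih i (by omega) h3 (fun i => ha (i + 2))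

theorem pre_getD {β : Type} (w : ℕ → β) {n i : ℕ} (h : i < n) (d : β) :
    (pre w n).getD i d = w i := by
  have : i < (pre w n).length := by rwa [length_pre]
  rw [List.getD_eq_getElem _ _ this]
  simp [pre]

theorem HasChar.mem {w : ℕ → Letter} {a : ℕ → ℕ} (h : HasChar w a) (n : ℕ) : w n ∈ Aminus := by
  have hl := le_length_wordOfChar a (n + 1)
  apply wordOfChar_mem (pre a (2 * (n + 1)))
  rw [← h (n + 1)]
  simp only [pre, List.mem_map, List.mem_range] at hl ⊢
  exact ⟨n, by omega, rfl⟩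

theorem HasChar.exists_ne_two {w : ℕ → Letter} {a : ℕ → ℕ} (h : HasChar w a)
    (ha : ∀ i, 1 ≤ a i) (N : ℕ) : ∃ n ≥ N, w n ≠ two := by
  induction N generalizing w a with
  | zero =>
    obtain ⟨-, h2, -⟩ := h.first_block
    exact ⟨_, Nat.zero_le _, by rw [h2]; exact fin_ne_two (ha 1)⟩
  | succ N ih =>
    obtain ⟨-, -, h3⟩ := h.first_block
    obtain ⟨n, hn, hw⟩ := ih h3 (fun i => ha (i + 2))
    exact ⟨_, by omega, hw⟩

theorem hatOfChar_pre_succ (a : ℕ → ℕ) (k : ℕ) : ∃ r, hatOfChar (pre a (2 * (k + 1))) =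
    Letter.fin (-1) (2 + a 0) :: (wordOfChar (pre (fun i => a (i + 1)) (2 * k)) ++ r) := by
  rw [show 2 * (k + 1) = 2 * k + 1 + 1 by ring, pre_cons, hatOfChar_cons, pre_succ,
    wordOfChar_append _ _ (by rw [length_pre]; exact even_two_mul k)]
  exact ⟨_, rfl⟩

theorem HasChar.hatStream_eq {w w' : ℕ → Letter} {a : ℕ → ℕ} (h : HasChar w a)
    (ha : ∀ i, 1 ≤ a i) (h' : HasChar w' (fun i => a (i + 1))) :
    hatStream w 0 = Letter.fin (-1) (2 + a 0) ∧ ∀ n, hatStream w (n + 1) = w' n := by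
  have key : ∀ n i, i ≤ n → hatStream w i =
      (Letter.fin (-1) (2 + a 0) :: pre w' (n + 1)).getD i Letter.inf := by
    intro n i hi
    -- With n + 2 blocks, the first letter is followed by the word of 2(n + 1) shifted terms, hence
    -- by at least n + 1 letters.
    obtain ⟨N, hN, e⟩ := hatStream_spec w (n + 1 + 1)
    simp only [h.charStream_eq ha, ENat.toNat_natCast] at e
    obtain ⟨r, hr⟩ := hatOfChar_pre_succ a (n + 1)
    change pre _ N = hatOfChar (pre a _) at e
    rw [hr, ← h' (n + 1)] at e
    have hl := le_length_wordOfChar (fun i => a (i + 1)) (n + 1)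
    rw [← pre_getD (hatStream w) (n := N) (by omega) Letter.inf, e]
    cases i with
    | zero => rfl
    | succ i =>
      rw [List.getD_cons_succ, List.getD_cons_succ, pre_getD _ (by omega),
        List.getD_append _ _ _ _ (by rw [length_pre]; omega), pre_getD _ (by omega)]
  refine ⟨key 0 0 le_rfl, fun n => ?_⟩
  rw [key (n + 1) (n + 1) le_rfl, List.getD_cons_succ, pre_getD _ (by omega)]

/-! ### Expansions on the complement of the synchronization set -/

/-- Cutting after 2k partial quotients leaves the tail G^(2k)(β) - 1, which lies in [α - 1, 0). The
cases β = α and β = G(α) describe the orbits of α - 1 and T_α(α) for minimal α; replacing α by 0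
gives the characteristic sequence of β - 1. -/
theorem hasChar_expansion {α β : ℝ} (h0 : 0 ≤ α) (hβ : ∀ n, gauss^[n] β ∈ Ioo (0 : ℝ) 1)
    (h : ∀ n, α ≤ gauss^[n] β) : HasChar (expansion α (β - 1)) (dig β) ∧
      ∀ n, (T α)^[n] (β - 1) < 0 := by
  have hβ1 : β ∈ Icc (0 : ℝ) 1 := ⟨(hβ 0).1.le, (hβ 0).2.le⟩
  have key : ∀ k, _ := fun k => orbit_sub_one (s := pre (dig β) (2 * k)) (v := β)
    (x := gauss^[2 * k] β - 1) h0
    ⟨by linarith [h (2 * k)], by linarith [(hβ (2 * k)).2]⟩ (by linarith [(hβ (2 * k)).1])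
    (pos_pre fun i _ => one_le_dig_of_pos hβ1 (hβ i).1)
    (by
      rw [cfWord_wordOfChar_of_even (pos_pre fun i _ => one_le_dig_of_pos hβ1 (hβ i).1)
        (by rw [length_pre]; exact even_two_mul k) (by linarith [(hβ (2 * k)).1]),
        add_sub_cancel, ← eq_rcf_pre hβ1.1])
    (fun m hm he => by
      rw [length_pre] at hm
      rw [cfWord_wordOfChar_of_even
        ((pos_pre fun i _ => one_le_dig_of_pos hβ1 (hβ i).1 : Pos (pre (dig β) (2 * k))).drop m)
        (by rw [List.length_drop, length_pre, Nat.even_sub hm.le]; simp [he])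
        (by linarith [(hβ (2 * k)).1]),
        add_sub_cancel, ← iterate_gauss_eq_rcf hβ1 hm.le]
      exact h m)
  refine ⟨fun k => (key k).1, fun n => ?_⟩
  have := le_length_wordOfChar (dig β) (n + 1)
  exact (key (n + 1)).2.2 n (by omega)

theorem gaussMinimal_mem_Ioo {α : ℝ} (hα : α ∈ gaussMinimal) (n : ℕ) :
    gauss^[n] α ∈ Ioo (0 : ℝ) 1 := by
  refine ⟨hα.1.1.trans_le (hα.2 n), ?_⟩
  cases n with
  | zero => exact (hα.2 1).trans_lt (gauss_lt_one α)
  | succ n =>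
    rw [Function.iterate_succ_apply']
    exact gauss_lt_one _

theorem one_le_dig_gaussMinimal {α : ℝ} (hα : α ∈ gaussMinimal) (i : ℕ) : 1 ≤ dig α i :=
  one_le_dig_of_pos ⟨hα.1.1.le, hα.1.2⟩ (gaussMinimal_mem_Ioo hα i).1

/-- Minimality puts G(α) - 1 into [α - 1, 0), so T_α takes the digit 1 + a₁ instead of a₁. -/
theorem T_self_gaussMinimal {α : ℝ} (hα : α ∈ gaussMinimal) :
    T α α = gauss α - 1 ∧ digit α α = Letter.fin 1 (1 + dig α 0) := by
  have h1 := gaussMinimal_mem_Ioo hα 1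
  have h2 := hα.2 1
  simp only [Function.iterate_one] at h1 h2
  have hd : (1 : ℝ) ≤ dig α 0 := by exact_mod_cast one_le_dig_gaussMinimal hα 0
  have e : α = ((1 : ℤ) : ℝ) / (((1 + dig α 0 : ℤ) : ℝ) + (gauss α - 1)) := by
    conv_lhs => rw [eq_inv_dig_add hα.1.1.le]
    push_cast
    rw [one_div]
    congr 1
    ring
  have := T_div (α := α) (ε := 1) (d := 1 + dig α 0) (t := gauss α - 1) (Or.inl rfl)
    ⟨by linarith, by linarith [hα.1.1, h1.2]⟩ (by push_cast; linarith [h1.1])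
  rwa [← e] at this

theorem hasChar_expansion_gauss {α : ℝ} (hα : α ∈ gaussMinimal) :
    HasChar (expansion α (gauss α - 1)) (fun i => dig α (i + 1)) ∧
      ∀ n, (T α)^[n] (gauss α - 1) < 0 := by
  refine hasChar_expansion (β := gauss α) hα.1.1.le (fun n => ?_) (fun n => ?_)
  · exact gaussMinimal_mem_Ioo hα (n + 1)
  · exact hα.2 (n + 1)

theorem gaussMinimal_not_mem {α : ℝ} (hα : α ∈ gaussMinimal) : α ∉ Γ := by
  rintro ⟨-, n, hn, h⟩
  rcases h with h | h
  · exact absurd h (not_le.2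
      ((hasChar_expansion hα.1.1.le (gaussMinimal_mem_Ioo hα) hα.2).2 n))
  · obtain ⟨n, rfl⟩ := Nat.exists_eq_add_of_le' hn
    rw [Function.iterate_succ_apply, (T_self_gaussMinimal hα).1] at h
    exact absurd h (not_le.2 ((hasChar_expansion_gauss hα).2 n))

theorem Γ_compl_eq : Ioc (0 : ℝ) 1 \ Γ = gaussMinimal := by
  ext α
  constructor
  · rintro ⟨h1, h2⟩
    by_contra h
    obtain ⟨v, hv, hα⟩ := exists_mem_Γv h1.1 h1.2 h
    exact h2 (Γv_subset hv hα)
  · exact fun h => ⟨h.1, gaussMinimal_not_mem h⟩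

theorem Γ_eq : Γ = ⋃ v ∈ F, Γv v := by
  ext α
  simp only [mem_iUnion]
  constructor
  · intro h
    have hn : α ∉ gaussMinimal := fun h' => gaussMinimal_not_mem h' h
    obtain ⟨v, hv, hα⟩ := exists_mem_Γv h.1.1 h.1.2 hn
    exact ⟨v, hv, hα⟩
  · rintro ⟨v, hv, hα⟩
    exact Γv_subset hv hα

theorem expansion_self_gaussMinimal {α : ℝ} (hα : α ∈ gaussMinimal) :
    (∀ n, expansion α (α - 1) n ∈ Aminus) ∧
      (∀ N, ∃ n ≥ N, expansion α (α - 1) n ≠ two) ∧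
      expansion α α = streamW (hatStream (expansion α (α - 1))) := by
  have h1 := (hasChar_expansion hα.1.1.le (gaussMinimal_mem_Ioo hα) hα.2).1
  have hd := one_le_dig_gaussMinimal hα
  obtain ⟨e1, e2⟩ := h1.hatStream_eq hd (hasChar_expansion_gauss hα).1
  refine ⟨h1.mem, h1.exists_ne_two hd, ?_⟩
  obtain ⟨t1, t2⟩ := T_self_gaussMinimal hα
  funext n
  cases n with
  | zero =>
    rw [streamW, e1]
    change digit α α = _
    rw [t2]
    simp [Letter.W]
    ring
  | succ n => rw [streamW, e2, expansion_succ, t1]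

/-! ### Comparison of characteristic sequences -/

theorem altLT_pre {a b : ℕ → ℕ} {j : ℕ} (h1 : ∀ i < j, a i = b i)
    (h2 : if Even j then a j < b j else b j < a j) : AltLT (pre a (j + 1)) (pre b (j + 1)) := by
  refine ⟨by rw [length_pre, length_pre], j, by rw [length_pre]; omega, ?_, ?_⟩
  · rw [take_pre _ _ _ (by omega), take_pre _ _ _ (by omega)]
    apply List.map_congr_left
    intro i hi
    exact h1 i (List.mem_range.1 hi)
  · rwa [pre_getD _ (by omega), pre_getD _ (by omega)]

theorem lt_of_altLTStream {x y : ℝ} (hx : ∀ n, gauss^[n] x ∈ Ioo (0 : ℝ) 1)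
    (hy : ∀ n, gauss^[n] y ∈ Ioo (0 : ℝ) 1)
    (h : AltLTStream (fun i => (dig x i : ℕ∞)) (fun i => (dig y i : ℕ∞))) : y < x := by
  obtain ⟨j, h1, h2⟩ := h
  simp only [Nat.cast_inj, Nat.cast_lt] at h1 h2
  have hx0 : x ∈ Icc (0 : ℝ) 1 := ⟨(hx 0).1.le, (hx 0).2.le⟩
  have hy0 : y ∈ Icc (0 : ℝ) 1 := ⟨(hy 0).1.le, (hy 0).2.le⟩
  exact lt_of_altLT_dig hx0.1 hy0.1 (pos_pre fun i _ => one_le_dig_of_pos hx0 (hx i).1)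
    (pos_pre fun i _ => one_le_dig_of_pos hy0 (hy i).1) (altLT_pre h1 h2)

theorem altLTStream_trichotomy (a b : ℕ → ℕ∞) :
    AltLTStream a b ∨ a = b ∨ AltLTStream b a := by
  classical
  by_cases h : a = b
  · exact Or.inr (Or.inl h)
  have hex : ∃ j, a j ≠ b j := by
    by_contra hc
    push Not at hc
    exact h (funext hc)
  have h1 := Nat.find_spec hex
  have h2 : ∀ i < Nat.find hex, a i = b i := fun i hi => not_not.1 (Nat.find_min hex hi)
  set j := Nat.find hex
  by_cases hj : Even j
  · rcases h1.lt_or_gt with h3 | h3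
    · exact Or.inl ⟨j, h2, by simpa [hj] using h3⟩
    · exact Or.inr (Or.inr ⟨j, fun i hi => (h2 i hi).symm, by simpa [hj] using h3⟩)
  · rcases h1.lt_or_gt with h3 | h3
    · exact Or.inr (Or.inr ⟨j, fun i hi => (h2 i hi).symm, by simpa [hj] using h3⟩)
    · exact Or.inl ⟨j, h2, by simpa [hj] using h3⟩

/-- A single inverse branch does not contract uniformly, but two in succession divide distances by
at least 2 · 2. -/
theorem abs_sub_le_of_dig_eq (k : ℕ) {x y : ℝ} (hx : ∀ n, gauss^[n] x ∈ Ioo (0 : ℝ) 1)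
    (hy : ∀ n, gauss^[n] y ∈ Ioo (0 : ℝ) 1) (h : dig x = dig y) : |x - y| ≤ (1 / 4) ^ k := by
  induction k generalizing x y with
  | zero =>
    have h1 := hx 0
    have h2 := hy 0
    simp only [Function.iterate_zero, id] at h1 h2
    rw [pow_zero, abs_le]
    constructor <;> linarith [h1.1, h1.2, h2.1, h2.2]
  | succ k ih =>
    have ih' := ih (x := gauss (gauss x)) (y := gauss (gauss y)) (fun n => hx (n + 2))
      (fun n => hy (n + 2)) (funext fun i => congrFun h (i + 2))
    have gx := (hx 2).1
    have gy := (hy 2).1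
    simp only [Function.iterate_succ, Function.iterate_zero, Function.comp, id] at gx gy
    have ha : (1 : ℝ) ≤ dig x 0 := by
      exact_mod_cast one_le_dig_of_pos ⟨(hx 0).1.le, (hx 0).2.le⟩ (hx 0).1
    have hb : (1 : ℝ) ≤ dig x 1 := by
      exact_mod_cast one_le_dig_of_pos (i := 1) ⟨(hx 0).1.le, (hx 0).2.le⟩ (hx 1).1
    have ex := eq_inv_dig_add (hx 0).1.le
    have ey := eq_inv_dig_add (hy 0).1.le
    simp only [Function.iterate_zero, id] at ex ey
    rw [eq_inv_dig_add (gauss_nonneg x), dig_gauss] at ex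
    rw [eq_inv_dig_add (gauss_nonneg y), dig_gauss, ← h] at ey
    simp only [zero_add] at ex ey
    set a : ℝ := ((dig x 0 : ℕ) : ℝ)
    set b : ℝ := ((dig x 1 : ℕ) : ℝ)
    set p := gauss (gauss x)
    set q := gauss (gauss y)
    have h1 : 2 ≤ a * (b + p) + 1 := by nlinarith
    have h2 : 2 ≤ a * (b + q) + 1 := by nlinarith
    have e : x - y = (p - q) / ((a * (b + p) + 1) * (a * (b + q) + 1)) := by
      rw [ex, ey]
      have h3 : b + p ≠ 0 := by linarith
      have h4 : b + q ≠ 0 := by linarith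
      have h5 : a * (b + p) + 1 ≠ 0 := by linarith
      have h6 : a * (b + q) + 1 ≠ 0 := by linarith
      have e1 : (a + (b + p)⁻¹)⁻¹ = (b + p) / (a * (b + p) + 1) := by
        rw [inv_eq_iff_eq_inv, inv_div]
        field_simp
      have e2 : (a + (b + q)⁻¹)⁻¹ = (b + q) / (a * (b + q) + 1) := by
        rw [inv_eq_iff_eq_inv, inv_div]
        field_simp
      rw [e1, e2, div_sub_div _ _ h5 h6]
      congr 1
      ring
    have hd : 4 ≤ (a * (b + p) + 1) * (a * (b + q) + 1) := by nlinarith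
    rw [e, abs_div, abs_of_pos (a := (a * (b + p) + 1) * (a * (b + q) + 1)) (by linarith),
      div_le_iff₀ (by linarith)]
    calc |p - q| ≤ (1 / 4) ^ k := ih'
      _ = (1 / 4) ^ (k + 1) * 4 := by ring
      _ ≤ _ := mul_le_mul_of_nonneg_left hd (by positivity)

theorem eq_of_dig_eq {x y : ℝ} (hx : ∀ n, gauss^[n] x ∈ Ioo (0 : ℝ) 1)
    (hy : ∀ n, gauss^[n] y ∈ Ioo (0 : ℝ) 1) (h : dig x = dig y) : x = y := by
  have h1 := ge_of_tendsto' (tendsto_pow_atTop_nhds_zero_of_lt_one (r := (1 / 4 : ℝ))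
    (by norm_num) (by norm_num)) fun k => abs_sub_le_of_dig_eq k hx hy h
  exact sub_eq_zero.1 (abs_eq_zero.1 (le_antisymm h1 (abs_nonneg _)))

theorem charNum_eq {α : ℝ} (hα : ∀ n, gauss^[n] α ∈ Ioo (0 : ℝ) 1) :
    charNum (α - 1) = fun i => (dig α i : ℕ∞) := by
  have h := (hasChar_expansion le_rfl hα (fun n => (hα n).1.le)).1
  funext i
  exact h.charStream_eq
    (fun i => one_le_dig_of_pos ⟨(hα 0).1.le, (hα 0).2.le⟩ (hα i).1) i

/-- Comparison of the shifted characteristic sequences amounts to minimality in the orbit. -/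
theorem altLEStream_shift_iff {α : ℝ} (hα : ∀ n, gauss^[n] α ∈ Ioo (0 : ℝ) 1) (n : ℕ) :
    AltLEStream (fun i => charNum (α - 1) (n + i)) (charNum (α - 1)) ↔ α ≤ gauss^[n] α := by
  have hn : ∀ m, gauss^[m] (gauss^[n] α) ∈ Ioo (0 : ℝ) 1 := fun m => by
    rw [← Function.iterate_add_apply]
    exact hα _
  rw [charNum_eq hα]
  simp only [← dig_iterate]
  constructor
  · rintro (h | h)
    · exact (lt_of_altLTStream hn hα h).le
    · exact (eq_of_dig_eq hn hα (funext fun i => by simpa using congrFun h i)).ge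
  · intro h
    rcases altLTStream_trichotomy (fun i => (dig (gauss^[n] α) i : ℕ∞))
      (fun i => (dig α i : ℕ∞)) with h1 | h1 | h1
    · exact Or.inl h1
    · exact Or.inr h1
    · exact absurd (lt_of_altLTStream hα hn h1) (not_lt.2 h)

/-! ### Numbers whose characteristic sequence is finite everywhere -/

theorem T_zero_mem {x : ℝ} (hx : x ∈ Ico (-1 : ℝ) 0) : T 0 x ∈ Ico (-1 : ℝ) 0 ∧
    digit 0 x ∈ Aminus ∧ x = cfWord [digit 0 x] (T 0 x) := by
  have hne : x ≠ 0 := hx.2.ne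
  have habs : |1 / x| = -(1 / x) := abs_of_neg (one_div_neg.2 hx.2)
  have h1 : 1 ≤ -(1 / x) := by
    rw [← one_div_neg_eq_neg_one_div, le_div_iff₀ (by linarith [hx.2])]
    linarith [hx.1]
  rw [T, digit, if_neg hne, if_neg hne, if_neg (not_le.2 hx.2), habs, sub_zero,
    Int.floor_add_one]
  have f1 := Int.floor_le (-(1 / x))
  have f2 := Int.lt_floor_add_one (-(1 / x))
  have f3 : 1 ≤ ⌊-(1 / x)⌋ := Int.le_floor.2 (by exact_mod_cast h1)
  refine ⟨?_, ⟨_, by omega, rfl⟩, ?_⟩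
  · push_cast
    constructor <;> linarith
  · simp only [cfWord]
    push_cast
    rw [add_sub_cancel]
    field_simp

theorem iterate_T_zero {x : ℝ} (hx : x ∈ Ico (-1 : ℝ) 0) (n : ℕ) :
    (T 0)^[n] x ∈ Ico (-1 : ℝ) 0 ∧ x = cfWord (pre (expansion 0 x) n) ((T 0)^[n] x) := by
  induction n with
  | zero => exact ⟨hx, rfl⟩
  | succ n ih =>
    obtain ⟨h1, h2, h3⟩ := T_zero_mem ih.1
    rw [Function.iterate_succ_apply']
    refine ⟨h1, ?_⟩
    have hm : ∀ a ∈ pre (expansion 0 x) n, a ∈ Aminus := by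
      intro a ha
      simp only [pre, List.mem_map, List.mem_range] at ha
      obtain ⟨i, hi, rfl⟩ := ha
      clear h1 h2 h3 ih
      have : ∀ i, (T 0)^[i] x ∈ Ico (-1 : ℝ) 0 := by
        intro i
        induction i with
        | zero => exact hx
        | succ i ih =>
          rw [Function.iterate_succ_apply']
          exact (T_zero_mem ih).1
      exact (T_zero_mem (this i)).2.1
    rw [pre_succ, cfWord_append _ _ hm]
    conv_lhs => rw [ih.2]
    congr 1

theorem expansion_zero_mem {x : ℝ} (hx : x ∈ Ico (-1 : ℝ) 0) (n : ℕ) :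
    expansion 0 x n ∈ Aminus := (T_zero_mem (iterate_T_zero hx n).1).2.1

theorem gauss_mem_of_charNum {α : ℝ} (h0 : 0 < α) (h1 : α < 1)
    (hc : ∀ i, charNum (α - 1) i ≠ ⊤) (n : ℕ) : gauss^[n] α ∈ Ioo (0 : ℝ) 1 := by
  have hx : α - 1 ∈ Ico (-1 : ℝ) 0 := ⟨by linarith, by linarith⟩
  have hw := expansion_zero_mem hx
  set a : ℕ → ℕ := fun i => (charNum (α - 1) i).toNat with ha
  have hpos : ∀ i, 1 ≤ a i := by
    intro i
    have := (charStream_spec _ hw (i + 1) (fun j _ => hc j)).1 i (by omega)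
    have h2 : ((a i : ℕ) : ℕ∞) = charNum (α - 1) i := ENat.natCast_toNat (hc i)
    change 1 ≤ charNum (α - 1) i at this
    rw [← h2] at this
    exact_mod_cast this
  -- The last remainder 1 + X is only known to lie in [0, 1). Two spare terms in front of it move
  -- the remainder into (0, 1], then into the open interval (0, 1).
  obtain ⟨-, L, hL, -⟩ := charStream_spec _ hw (n + 1 + 1) (fun j _ => hc j)
  change pre _ L = wordOfChar (pre a _) at hL
  obtain ⟨g1, g2⟩ := iterate_T_zero hx L
  set X := (T 0)^[L] (α - 1)
  have hs : ∀ k, Pos (pre a k) := fun k => pos_pre fun i _ => hpos i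
  have e : α = rcf (pre a (2 * (n + 1 + 1))) (1 + X) := by
    rw [← cfWord_wordOfChar_of_even (hs _) (by rw [length_pre]; exact even_two_mul _)
      (by linarith [g1.1]), ← hL, ← g2]
    ring
  have hθ : 0 ≤ 1 + X := by linarith [g1.1]
  set s := pre a (2 * (n + 1))
  have e' : α = rcf s (rcf [a (2 * (n + 1)), a (2 * (n + 1) + 1)] (1 + X)) := by
    rw [← rcf_append, e, show 2 * (n + 1 + 1) = 2 * (n + 1) + 1 + 1 by ring, pre_succ, pre_succ]
    simp [s]
  have hp2 : Pos [a (2 * (n + 1) + 1)] := by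
    intro b hb
    rw [List.mem_singleton] at hb
    exact hb ▸ hpos _
  have hy0 : 0 < rcf [a (2 * (n + 1) + 1)] (1 + X) := rcf_pos hp2 (by simp) (by linarith)
  have hp1 : Pos [a (2 * (n + 1))] := by
    intro b hb
    rw [List.mem_singleton] at hb
    exact hb ▸ hpos _
  have hy1 := rcf_pos hp1 (by simp) (y := rcf [a (2 * (n + 1) + 1)] (1 + X)) (by linarith)
  have hy2 := rcf_lt_one hp1 (by simp) hy0
  rw [← rcf_append, List.singleton_append] at hy1 hy2
  set y := rcf [a (2 * (n + 1)), a (2 * (n + 1) + 1)] (1 + X)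
  have hlt : ∀ m ≤ s.length, 0 < rcf (s.drop m) y ∧ rcf (s.drop m) y < 1 := by
    intro m hm
    rcases hm.eq_or_lt with rfl | hm
    · rw [List.drop_length]
      exact ⟨hy1, hy2⟩
    · have hne : s.drop m ≠ [] := List.ne_nil_of_length_pos (by simpa using hm)
      exact ⟨rcf_pos ((hs _).drop m) hne (by linarith), rcf_lt_one ((hs _).drop m) hne hy1⟩
  have hn : n ≤ s.length := by
    simp only [s, length_pre]
    omega
  rw [e', (rcf_orbit (fun m _ hm => ⟨(hlt m hm).1.le, (hlt m hm).2⟩)).2 n hn]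
  exact hlt n hn

/-- An expansion beginning with n letters (-1:2) forces α ≤ 1/(n + 1). -/
theorem charNum_zero_ne_top {α : ℝ} (h0 : 0 < α) (h1 : α < 1) : charNum (α - 1) 0 ≠ ⊤ := by
  intro h
  have hx : α - 1 ∈ Ico (-1 : ℝ) 0 := ⟨by linarith, by linarith⟩
  have htwo := (charStream_eq_top (expansion 0 (α - 1)) 0 h).1
  simp only [Function.iterate_zero, id] at htwo
  obtain ⟨n, hn⟩ := exists_nat_one_div_lt h0
  obtain ⟨g1, g2⟩ := iterate_T_zero hx n
  have hp : pre (expansion 0 (α - 1)) n = List.replicate n two := by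
    rw [List.eq_replicate_iff]
    refine ⟨length_pre _ _, fun b hb => ?_⟩
    simp only [pre, List.mem_map] at hb
    obtain ⟨i, -, rfl⟩ := hb
    exact htwo i
  rw [hp] at g2
  have hle := cfWord_mono (List.replicate n two)
    (fun x hx => List.eq_of_mem_replicate hx ▸ two_mem_Aminus) _ 0 g1.1 g1.2.le le_rfl
  have e := cfWord_replicate_two n [] (x := 0) (by simp [cfWord])
  rw [List.append_nil] at e
  simp only [cfWord, add_zero, one_div_one] at e
  rw [one_div] at e hn
  linarith

/-- An infinite term would make some proper shift constantly ∞, which is above the whole sequence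
because the first term is finite. -/
theorem charNum_ne_top {α : ℝ} (h0 : 0 < α) (h1 : α < 1)
    (h : ∀ n : ℕ, 1 ≤ n → AltLEStream (fun i => charNum (α - 1) (n + i)) (charNum (α - 1)))
    (i : ℕ) : charNum (α - 1) i ≠ ⊤ := by
  intro hi
  have h2 : charNum (α - 1) (2 * (i / 2)) = ⊤ := by
    rcases Nat.even_or_odd' i with ⟨k, rfl | rfl⟩
    · rwa [Nat.mul_div_cancel_left k (by norm_num)]
    · rw [show (2 * k + 1) / 2 = k by omega]
      exact (charStream_finite_pair _ k).2 hi
  have htop := (charStream_eq_top _ _ h2).2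
  have hne := charNum_zero_ne_top h0 h1
  have e : (fun j => charNum (α - 1) (2 * (i / 2) + 1 + j)) = fun _ => ⊤ :=
    funext fun j => htop _ (by omega)
  have := h (2 * (i / 2) + 1) (by omega)
  rw [e] at this
  rcases this with ⟨j, hj1, hj2⟩ | hE
  · cases j with
    | zero => simp at hj2
    | succ j => exact hne (hj1 0 (by omega)).symm
  · exact hne (congrFun hE 0).symm

theorem nil_mem_F : [] ∈ F := by
  have := wordOfChar_mem_F (s := [1]) (by simp [Pos]) (by simp) (fun m h1 hm => by
    simp at hm
    omega)
  simpa [wordOfChar] using this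

theorem g_lt_one : g < 1 := by
  have : Real.sqrt 5 < 3 := by
    rw [Real.sqrt_lt'] <;> norm_num
  rw [g]
  linarith

/-- The bound by g reflects that (g, 1] is the interval of the empty label. In the other direction
it serves to exclude α = 1, where α - 1 = 0 has no characteristic sequence. -/
theorem mem_compl_iff (α : ℝ) : α ∈ Ioc (0 : ℝ) 1 \ Γ ↔ α ∈ Ioc (0 : ℝ) g ∧
    ∀ n : ℕ, 1 ≤ n → AltLEStream (fun i => charNum (α - 1) (n + i)) (charNum (α - 1)) := by
  constructor
  · intro h
    have hg : α ≤ g := by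
      by_contra hc
      refine h.2 (Γv_subset nil_mem_F ?_)
      rw [Γv, if_pos rfl]
      exact ⟨not_le.1 hc, h.1.2⟩
    rw [Γ_compl_eq] at h
    exact ⟨⟨h.1.1, hg⟩, fun n _ =>
      (altLEStream_shift_iff (gaussMinimal_mem_Ioo h) n).2 (h.2 n)⟩
  · rintro ⟨⟨h0, hg⟩, h⟩
    have h1 : α < 1 := hg.trans_lt g_lt_one
    have hm := gauss_mem_of_charNum h0 h1 (charNum_ne_top h0 h1 h)
    rw [Γ_compl_eq]
    refine ⟨⟨h0, h1.le⟩, fun n => ?_⟩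
    cases n with
    | zero => exact le_rfl
    | succ n => exact (altLEStream_shift_iff hm _).1 (h (n + 1) (by omega))


/-! ### Measure zero -/

theorem measurable_gauss : Measurable gauss := measurable_fract.comp measurable_inv

/-- The numbers whose orbit under the Gauss map is bounded below by `1 / M`. -/
def gaussBounded (M : ℕ) : Set ℝ := {x | x ∈ Ioo (0 : ℝ) 1 ∧ ∀ n, 1 / (M : ℝ) ≤ gauss^[n] x}

theorem measurableSet_gaussBounded (M : ℕ) : MeasurableSet (gaussBounded M) := by
  have : gaussBounded M = Ioo (0 : ℝ) 1 ∩ ⋂ n, {x | 1 / (M : ℝ) ≤ gauss^[n] x} := by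
    ext x
    simp [gaussBounded]
  rw [this]
  exact measurableSet_Ioo.inter (MeasurableSet.iInter fun n =>
    measurableSet_le measurable_const (measurable_gauss.iterate n))

theorem gaussBounded_subset {M : ℕ} (hM : 1 ≤ M) : gaussBounded M ⊆
    ⋃ i : Fin M, (fun x : ℝ => ((i : ℕ) + 1 + x)⁻¹) '' gaussBounded M := by
  rintro x ⟨⟨h0, h1⟩, h⟩
  have hM' : (0 : ℝ) < M := by exact_mod_cast hM
  have hd := one_le_dig h0 h1.le
  have hx : x⁻¹ ≤ M := by
    have := h 0
    simp only [Function.iterate_zero, id] at this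
    rw [inv_le_comm₀ h0 hM', ← one_div]
    exact this
  have hle : dig x 0 ≤ M := by
    have : dig x 0 ≤ ⌊(M : ℝ)⌋₊ := Nat.floor_le_floor hx
    rwa [Nat.floor_natCast] at this
  -- The first partial quotient lies between 1 and M, and the branches are numbered from 0.
  refine mem_iUnion.2 ⟨⟨dig x 0 - 1, by omega⟩, gauss x, ⟨⟨?_, gauss_lt_one x⟩, fun n => h (n + 1)⟩, ?_⟩
  · exact (one_div_pos.2 hM').trans_le (h 1)
  · simp only [Nat.cast_sub hd, Nat.cast_one, sub_add_cancel]
    exact (eq_inv_dig_add h0.le).symm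

/-- The Gauss density pulled back by a branch is 1/((i + 1 + x)(i + 2 + x)), written as a difference
that telescopes over i. -/
theorem lintegral_image_branch {B : Set ℝ} (hB : MeasurableSet B) (h0 : ∀ x ∈ B, 0 < x) (i : ℕ) :
    ∫⁻ x in (fun x : ℝ => ((i : ℝ) + 1 + x)⁻¹) '' B, ENNReal.ofReal (1 / (1 + x)) =
      ∫⁻ x in B, ENNReal.ofReal (1 / (i + 1 + x) - 1 / ((i + 1 : ℕ) + 1 + x)) := by
  have hi : (0 : ℝ) ≤ i := Nat.cast_nonneg i
  rw [lintegral_image_eq_lintegral_abs_deriv_mul hB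
    (f' := fun x => -1 / ((i : ℝ) + 1 + x) ^ 2)]
  · apply setLIntegral_congr_fun hB
    intro x hx
    have hx0 := h0 x hx
    have h1 : 0 < (i : ℝ) + 1 + x := by linarith
    simp only
    rw [← ENNReal.ofReal_mul (abs_nonneg _), abs_div, abs_of_pos (a := ((i : ℝ) + 1 + x) ^ 2)
      (by positivity)]
    congr 1
    push_cast
    have h2 : (i : ℝ) + 1 + 1 + x ≠ 0 := by linarith
    have h3 : 1 + ((i : ℝ) + 1 + x)⁻¹ = (i + 1 + 1 + x) / (i + 1 + x) := by
      field_simp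
      ring
    rw [h3, abs_neg, abs_one]
    field_simp
    ring
  · intro x hx
    have hx0 := h0 x hx
    have h1 : (i : ℝ) + 1 + x ≠ 0 := by linarith
    exact (((hasDerivAt_id x).const_add ((i : ℝ) + 1)).inv h1).hasDerivWithinAt
  · intro x _ y _ h
    simpa using h

/-- The Gauss measure of the set drops by an explicit positive amount under the inverse branches
that are allowed, hence it vanishes. -/
theorem volume_gaussBounded {M : ℕ} (hM : 1 ≤ M) : volume (gaussBounded M) = 0 := by
  set B := gaussBounded M with hBdef
  have hB : MeasurableSet B := measurableSet_gaussBounded M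
  have h0 : ∀ x ∈ B, 0 < x := fun x hx => hx.1.1
  have hmeas : ∀ c : ℝ, Measurable fun x : ℝ => ENNReal.ofReal (1 / (c + x)) := fun c => by
    fun_prop
  -- Summing over all branches would reproduce the density; stopping after M of them loses the term
  -- 1/(M + 1 + x).
  have hle : ∫⁻ x in B, ENNReal.ofReal (1 / (1 + x)) ≤
      ∫⁻ x in B, ENNReal.ofReal (1 / (1 + x) - 1 / (M + 1 + x)) := by
    calc ∫⁻ x in B, ENNReal.ofReal (1 / (1 + x))
        ≤ ∫⁻ x in ⋃ i : Fin M, (fun x : ℝ => ((i : ℕ) + 1 + x)⁻¹) '' B,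
            ENNReal.ofReal (1 / (1 + x)) := lintegral_mono_set (gaussBounded_subset hM)
      _ ≤ ∑' i : Fin M, ∫⁻ x in (fun x : ℝ => (((i : ℕ) : ℝ) + 1 + x)⁻¹) '' B,
            ENNReal.ofReal (1 / (1 + x)) := lintegral_iUnion_le _ _
      _ = ∑ i : Fin M, ∫⁻ x in B,
            ENNReal.ofReal (1 / ((i : ℕ) + 1 + x) - 1 / (((i : ℕ) + 1 : ℕ) + 1 + x)) := by
          rw [tsum_fintype]
          exact Finset.sum_congr rfl fun i _ => lintegral_image_branch hB h0 i
      _ = ∫⁻ x in B, ∑ i : Fin M,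
            ENNReal.ofReal (1 / ((i : ℕ) + 1 + x) - 1 / (((i : ℕ) + 1 : ℕ) + 1 + x)) := by
          rw [lintegral_finsetSum]
          intro i _
          fun_prop
      _ = _ := by
          apply setLIntegral_congr_fun hB
          intro x hx
          have hx0 := h0 x hx
          simp only
          rw [← ENNReal.ofReal_sum_of_nonneg,
            Fin.sum_univ_eq_sum_range
              (fun i : ℕ => 1 / ((i : ℝ) + 1 + x) - 1 / ((i + 1 : ℕ) + 1 + x)) M,
            Finset.sum_range_sub' (fun i : ℕ => 1 / ((i : ℝ) + 1 + x))]
          · simp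
          · intro i _
            have : (0 : ℝ) ≤ (i : ℕ) := Nat.cast_nonneg _
            rw [sub_nonneg]
            apply one_div_le_one_div_of_le
            · linarith
            · push_cast
              linarith
  have hsplit : ∫⁻ x in B, ENNReal.ofReal (1 / (1 + x)) =
      (∫⁻ x in B, ENNReal.ofReal (1 / (1 + x) - 1 / (M + 1 + x))) +
        ∫⁻ x in B, ENNReal.ofReal (1 / (M + 1 + x)) := by
    rw [← lintegral_add_right _ (hmeas (M + 1))]
    apply setLIntegral_congr_fun hB
    intro x hx
    have hx0 := h0 x hx
    have hM' : (0 : ℝ) ≤ M := Nat.cast_nonneg _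
    simp only
    rw [← ENNReal.ofReal_add, sub_add_cancel]
    · rw [sub_nonneg]
      apply one_div_le_one_div_of_le <;> linarith
    · positivity
  -- Finiteness permits cancelling, so that the lost integral of a positive function is 0.
  have hfin : ∫⁻ x in B, ENNReal.ofReal (1 / (1 + x) - 1 / (M + 1 + x)) ≠ ⊤ := by
    refine ne_top_of_le_ne_top (b := volume (Ioo (0 : ℝ) 1)) (by simp) ?_
    calc ∫⁻ x in B, ENNReal.ofReal (1 / (1 + x) - 1 / (M + 1 + x))
        ≤ ∫⁻ x in B, 1 := by
          apply setLIntegral_mono measurable_const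
          intro x hx
          have hx0 := h0 x hx
          have hM' : (0 : ℝ) ≤ M := Nat.cast_nonneg _
          rw [← ENNReal.ofReal_one]
          apply ENNReal.ofReal_le_ofReal
          have h1 : 0 ≤ 1 / ((M : ℝ) + 1 + x) := by positivity
          have h2 : 1 / (1 + x) ≤ 1 := by
            rw [div_le_one (by linarith)]
            linarith
          linarith
      _ = volume B := by simp
      _ ≤ _ := measure_mono fun x hx => hx.1
  rw [hsplit] at hle
  have hzero : ∫⁻ x in B, ENNReal.ofReal (1 / (M + 1 + x)) = 0 := by
    by_contra hne
    exact absurd hle (not_le.2 (ENNReal.lt_add_right hfin hne))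
  rw [setLIntegral_eq_zero_iff hB (hmeas _), ae_iff] at hzero
  refine measure_mono_null ?_ hzero
  intro x hx hc
  have hx0 := h0 x hx
  have hM' : (0 : ℝ) ≤ M := Nat.cast_nonneg _
  have := hc hx
  rw [ENNReal.ofReal_eq_zero] at this
  exact absurd this (not_le.2 (by positivity))

/-- The orbit of a minimal number α > 1/(n + 1) never drops below 1/(n + 1). -/
theorem volume_gaussMinimal : volume gaussMinimal = 0 := by
  refine measure_mono_null (t := ⋃ M : ℕ, gaussBounded (M + 1)) ?_
    (measure_iUnion_null fun M => volume_gaussBounded (by omega))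
  intro α hα
  obtain ⟨n, hn⟩ := exists_nat_one_div_lt hα.1.1
  refine mem_iUnion.2 ⟨n, gaussMinimal_mem_Ioo hα 0, fun m => ?_⟩
  push_cast
  exact hn.le.trans (hα.2 m)

end AlphaCF

/-! ### The theorem -/

theorem theoremt :
    -- `Γ` is the disjoint union of the (non-degenerate) intervals `Γ_v`, `v ∈ F`
    ((∀ v ∈ F, ζ v < η v) ∧ Γ = (⋃ v ∈ F, Γv v) ∧ F.PairwiseDisjoint Γv) ∧
    -- synchronization on `Γ_v`
    (∀ v ∈ F, ∀ α ∈ Γv v,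
      pre (expansion α (α - 1)) v.length = v ∧
      pre (expansion α α) (hat v).length = wordW (wordShift (-1) (hat v)) ∧
      expansion α α (hat v).length = (expansion α (α - 1) v.length).W ∧
      (T α)^[v.length + 1] (α - 1) = (T α)^[(hat v).length + 1] α) ∧
    -- the complement of `Γ` in terms of the characteristic sequence of `α - 1`
    (∀ α : ℝ, α ∈ Ioc (0 : ℝ) 1 \ Γ ↔
      α ∈ Ioc (0 : ℝ) g ∧
        ∀ n : ℕ, 1 ≤ n → AltLEStream (fun i => charNum (α - 1) (n + i)) (charNum (α - 1))) ∧
    -- the complement is a null set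
    volume (Ioc (0 : ℝ) 1 \ Γ) = 0 ∧
    -- the expansions of `α - 1` and `α` on the complement; the first two clauses say that the
    -- operation `w ↦ ŵ` is applicable
    (∀ α ∈ Ioc (0 : ℝ) 1 \ Γ,
      (∀ n, expansion α (α - 1) n ∈ Aminus) ∧
      (∀ N, ∃ n ≥ N, expansion α (α - 1) n ≠ two) ∧
      expansion α α = streamW (hatStream (expansion α (α - 1)))) := by
  refine ⟨⟨fun v hv => ζ_lt_η hv.1, Γ_eq, pairwiseDisjoint_Γv⟩, fun v hv α hα => ?_,
    mem_compl_iff, ?_, fun α hα => ?_⟩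
  · obtain ⟨x, y, hx, hxy, h1, h2, h3, h4⟩ := synchronization hv hα
    obtain ⟨h5, h6⟩ := merge (α := α) hx hxy
    refine ⟨h1, h2, ?_, ?_⟩
    · rw [expansion, expansion, h3, h4, h5]
    · rw [Function.iterate_succ_apply', Function.iterate_succ_apply', h3, h4, h6]
  · rw [Γ_compl_eq]
    exact volume_gaussMinimal
  · rw [Γ_compl_eq] at hα
    exact expansion_self_gaussMinimal hα
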